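/- Let $S$ be an inverse semigroup, with $\mathbf d(s)=s^{-1}s$, $\mathbf r(s)=ss^{-1}$, semilattice of idempotents $E(S)$ and natural partial order $s\le t\iff s=te$ for some $e\in E(S)$; for $A\subseteq S$ let $A^{\uparrow}=\{s\in S: s\ge a\text{ for some }a\in A\}$. Let $X$ be a topological space. *Loganathan's category* $L(S)$ has the idempotents of $S$ as objects; its arrows $e\to f$ are the pairs $(f,s)$ with $s\in S$, $\mathbf d(s)=e$ and $\mathbf r(s)\le f$; the composition is $(g,t)(f,s)=(g,ts)$. Let $\mathsf{Prin}(S,X)$ be the category of principal bundles over $S$ on $X$: its objects are the functors $E\colon L(S)\to\mathsf{Sh}(X)$ to sheaves of sets on $X$ such that, for each $x\in X$ (writing $\alpha\cdot y=E(\alpha)(y)$ on stalks), (PB1) $E(c)_x\neq\varnothing$ for some object $c$; (PB2) for any $y\in E(c)_x$ and $z\in E(d)_x$ there are arrows $\alpha\colon b\to c$, $\beta\colon b\to d$ and $w\in E(b)_x$ with $\alpha\cdot w=y$ and $\beta\cdot w=z$; (PB3) for any parallel arrows $\alpha,\beta\colon c\rightrightarrows d$ and $y\in E(c)_x$ with $\alpha\cdot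 y=\beta\cdot y$ there are an arrow $\gamma\colon b\to c$ and $z\in E(b)_x$ with $\alpha\gamma=\beta\gamma$ and $\gamma\cdot z=y$. Its morphisms are all natural transformations. An $S$-*set* is a set $Y$ with a homomorphism from $S$ to the symmetric inverse semigroup of partial bijections of $Y$ (a left action by partial bijections, $s\cdot y$ being defined when $y$ is in the domain of the partial bijection of $s$), such that every point of $Y$ is in the domain of the action of some $s\in S$. It is *universal* if, for some non-empty filter $F$ of the semilattice $E(S)$ and $H=F^{\uparrow}$, it is equivalent to the $S$-set of cosets $(xH)^{\uparrow}$, $\mathbf d(x)\in H$, on which $s\cdot(xH)^{\uparrow}$ is defined if and only if $(sxH)^{\uparrow}$ is a coset, and is then equal to $(sxH)^{\uparrow}$. Let $\mathsf{Univ}(S,X)$ be the category whose objects are the étale spaces $\pi\colon E\to X$ (local homeomorphisms) together with the structure of an $S$-set on $E$ such that (U1) for each $x\in X$ there is $e\in E_x=\pi^{-1}(x)$ such that $s\cdot e$ is defined for some $s\in S$; (U2) for each $s\in S$ the set $\{e\in E: s\cdot e\text{ is defined}\}$ is open; (U3) if $s\cdot e$ is defined then $\pi(s\cdot e)=\pi(e)$;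 (U4) for each $x\in X$ the stalk $E_x$ with the restricted action is a universal $S$-set; (U5) the partially defined map $S\times E\to E$, $(s,e)\mapsto s\cdot e$, is continuous, where $S$ is discrete. Its morphisms are the continuous maps $f$ over $X$ such that, whenever $s\cdot e$ is defined, $s\cdot f(e)$ is defined and $f(s\cdot e)=s\cdot f(e)$. Then the categories $\mathsf{Prin}(S,X)$ and $\mathsf{Univ}(S,X)$ are equivalent. -/

import Mathlib

open CategoryTheory TopologicalSpace

universe u

/-- An inverse semigroup: every element `s` has a unique generalized inverse `s⁻¹`. -/
class InverseSemigroup (S : Type u) extends Semigroup S, Inv S where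
  mul_inv_mul : ∀ s : S, s * s⁻¹ * s = s
  inv_mul_inv : ∀ s : S, s⁻¹ * s * s⁻¹ = s⁻¹
  inv_unique : ∀ s t : S, s * t * s = s → t * s * t = t → t = s⁻¹

namespace InverseSemigroup

variable {S : Type u} [InverseSemigroup S]

/-- The domain idempotent `𝐝(s) = s⁻¹ s`. -/
def d (s : S) : S := s⁻¹ * s

/-- The range idempotent `𝐫(s) = s s⁻¹`. -/
def r (s : S) : S := s * s⁻¹

/-- The natural partial order: `s ≤ t` iff `s = t e` for some idempotent `e`. -/
def NatLE (s t : S) : Prop := ∃ e : S, IsIdempotentElem e ∧ s = t * e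

/-- The upward closure of a subset with respect to the natural partial order. -/
def upClosure (A : Set S) : Set S := {s | ∃ a ∈ A, NatLE a s}

theorem inv_eq_self {e : S} (he : IsIdempotentElem e) : e⁻¹ = e := by
  have h : e * e = e := he
  exact (inv_unique e e (by rw [h, h]) (by rw [h, h])).symm

theorem isIdempotentElem_d (s : S) : IsIdempotentElem (d s) := by
  change s⁻¹ * s * (s⁻¹ * s) = s⁻¹ * s
  rw [← mul_assoc, inv_mul_inv]

theorem isIdempotentElem_r (s : S) : IsIdempotentElem (r s) := by
  change s * s⁻¹ * (s * s⁻¹) = s * s⁻¹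
  rw [← mul_assoc, mul_inv_mul]

theorem d_idem {e : S} (he : IsIdempotentElem e) : d e = e := by
  unfold d
  rw [inv_eq_self he]
  exact he

theorem isIdempotentElem_mul {e f : S} (he : IsIdempotentElem e) (hf : IsIdempotentElem f) :
    IsIdempotentElem (e * f) := by
  have he' : ∀ a : S, e * (e * a) = e * a := fun a => by rw [← mul_assoc, he.eq]
  have hf' : ∀ a : S, f * (f * a) = f * a := fun a => by rw [← mul_assoc, hf.eq]
  -- `f x e` is again an inverse of `e f`, where `x` is the inverse of `e f`
  have h1 : e * f * (e * f)⁻¹ * (e * f) = e * f := mul_inv_mul _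
  have h2 : (e * f)⁻¹ * (e * f) * (e * f)⁻¹ = (e * f)⁻¹ := inv_mul_inv _
  generalize hx : (e * f)⁻¹ = x at h1 h2
  simp only [mul_assoc] at h1 h2
  have h2' : ∀ a : S, x * (e * (f * (x * a))) = x * a := fun a => by
    have := congrArg (· * a) h2
    simpa only [mul_assoc] using this
  have key : f * x * e = x := by
    rw [← hx]
    apply inv_unique <;> rw [hx]
    · simp only [mul_assoc, he', hf', h1]
    · simp only [mul_assoc, he', hf', h2']
  have hxi : IsIdempotentElem x := by
    change x * x = x
    have h3 : f * x * e * (f * x * e) = f * x * e := by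
      simp only [mul_assoc, h2']
    rwa [key] at h3
  have h4 : e * f = x⁻¹ := inv_unique x (e * f) (by simpa only [mul_assoc] using h2)
    (by simpa only [mul_assoc] using h1)
  rw [h4, inv_eq_self hxi]
  exact hxi

theorem idem_comm {e f : S} (he : IsIdempotentElem e) (hf : IsIdempotentElem f) :
    e * f = f * e := by
  have he' : ∀ a : S, e * (e * a) = e * a := fun a => by rw [← mul_assoc, he.eq]
  have hf' : ∀ a : S, f * (f * a) = f * a := fun a => by rw [← mul_assoc, hf.eq]
  have h1 : e * (f * (e * f)) = e * f := by
    simpa only [mul_assoc] using (isIdempotentElem_mul he hf).eq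
  have h2 : f * (e * (f * e)) = f * e := by
    simpa only [mul_assoc] using (isIdempotentElem_mul hf he).eq
  have h3 : f * e = (e * f)⁻¹ := by
    apply inv_unique
    · simp only [mul_assoc, he', hf', h1]
    · simp only [mul_assoc, he', hf', h2]
  rw [h3, inv_eq_self (isIdempotentElem_mul he hf)]

theorem mul_inv_rev' (s t : S) : (s * t)⁻¹ = t⁻¹ * s⁻¹ := by
  have hc : t * t⁻¹ * (s⁻¹ * s) = s⁻¹ * s * (t * t⁻¹) :=
    idem_comm (isIdempotentElem_r t) (isIdempotentElem_d s)
  symm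
  apply inv_unique
  · calc s * t * (t⁻¹ * s⁻¹) * (s * t) = s * (t * t⁻¹ * (s⁻¹ * s)) * t := by
          simp only [mul_assoc]
      _ = (s * s⁻¹ * s) * (t * t⁻¹ * t) := by rw [hc]; simp only [mul_assoc]
      _ = s * t := by rw [mul_inv_mul, mul_inv_mul]
  · calc t⁻¹ * s⁻¹ * (s * t) * (t⁻¹ * s⁻¹) = t⁻¹ * (s⁻¹ * s * (t * t⁻¹)) * s⁻¹ := by
          simp only [mul_assoc]
      _ = (t⁻¹ * t * t⁻¹) * (s⁻¹ * s * s⁻¹) := by rw [← hc]; simp only [mul_assoc]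
      _ = t⁻¹ * s⁻¹ := by rw [inv_mul_inv, inv_mul_inv]

/-- `f s = s` says exactly that `𝐫(s) ≤ f`. -/
theorem mul_eq_self_iff {f s : S} (hf : IsIdempotentElem f) : f * s = s ↔ NatLE (r s) f := by
  constructor
  · intro h
    exact ⟨r s, isIdempotentElem_r s, by unfold r; rw [← mul_assoc, h]⟩
  · rintro ⟨e, -, he⟩
    have h : f * r s = r s := by rw [he, ← mul_assoc, hf.eq]
    calc f * s = f * (s * s⁻¹ * s) := by rw [mul_inv_mul]
      _ = f * r s * s := by unfold r; simp only [mul_assoc]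
      _ = s := by rw [h]; exact mul_inv_mul s

end InverseSemigroup

open InverseSemigroup

/-! ### Loganathan's category -/

/-- Objects of Loganathan's category `L(S)`: the idempotents of `S`. -/
structure Loganathan (S : Type u) [InverseSemigroup S] : Type u where
  idem : S
  isIdem : IsIdempotentElem idem

namespace Loganathan

variable {S : Type u} [InverseSemigroup S]

/-- The arrows `e ⟶ f` of `L(S)`: the pairs `(f, s)` with `𝐝(s) = e` and `𝐫(s) ≤ f`,
the latter condition being written as `f s = s`. -/
@[ext]
structure Hom (e f : Loganathan S) : Type u where
  elt : S
  d_elt : d elt = e.idem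
  mul_elt : f.idem * elt = elt

/-- The composition is `(g, t) (f, s) = (g, t s)`, and the identity at `e` is `(e, e)`. -/
instance : SmallCategory (Loganathan S) where
  Hom e f := Hom e f
  id e := ⟨e.idem, d_idem e.isIdem, e.isIdem⟩
  comp {e f g} α β := ⟨β.elt * α.elt, by
    have h : d (β.elt * α.elt) = α.elt⁻¹ * (d β.elt * α.elt) := by
      unfold d
      rw [mul_inv_rev']
      simp only [mul_assoc]
    rw [h, β.d_elt, α.mul_elt]
    exact α.d_elt, by rw [← mul_assoc, β.mul_elt]⟩
  id_comp {e f} α := Hom.ext (by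
    change α.elt * e.idem = α.elt
    rw [← α.d_elt]
    unfold d
    rw [← mul_assoc, mul_inv_mul])
  comp_id α := Hom.ext α.mul_elt
  assoc α β γ := Hom.ext (mul_assoc γ.elt β.elt α.elt).symm

end Loganathan

/-! ### Principal bundles -/

section Prin

variable {C : Type u} [SmallCategory C] {X : TopCat.{u}}

/-- The stalk `E(c)_x` of a `C`-bundle `E`. -/
noncomputable abbrev bundleStalk (E : C ⥤ TopCat.Sheaf (Type u) X) (x : X) (c : C) : Type u :=
  (E.obj c).presheaf.stalk x

/-- The map `y ↦ α · y` on stalks over `x` that is induced by an arrow `α : c ⟶ d`. -/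
noncomputable def bundleAct (E : C ⥤ TopCat.Sheaf (Type u) X) (x : X) {c d : C} (α : c ⟶ d)
    (y : bundleStalk E x c) : bundleStalk E x d :=
  (TopCat.Presheaf.stalkFunctor (Type u) x).map (E.map α).hom y

/-- A `C`-bundle, that is a functor `E : C ⥤ Sh(X)`, is principal if its stalks over each point
are non-empty, transitive and free. -/
structure IsPrincipal (E : C ⥤ TopCat.Sheaf (Type u) X) : Prop where
  nonempty : ∀ x : X, ∃ c : C, Nonempty (bundleStalk E x c)
  transitive : ∀ (x : X) (c d : C) (y : bundleStalk E x c) (z : bundleStalk E x d),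
    ∃ (b : C) (α : b ⟶ c) (β : b ⟶ d) (w : bundleStalk E x b),
      bundleAct E x α w = y ∧ bundleAct E x β w = z
  free : ∀ (x : X) (c d : C) (α β : c ⟶ d) (y : bundleStalk E x c),
    bundleAct E x α y = bundleAct E x β y →
      ∃ (b : C) (γ : b ⟶ c) (z : bundleStalk E x b), γ ≫ α = γ ≫ β ∧ bundleAct E x γ z = y

end Prin

/-- The category of principal bundles over an inverse semigroup `S` on the space `X`: principal
functors `L(S) ⥤ Sh(X)` and all natural transformations between them. -/
abbrev Prin (S : Type u) [InverseSemigroup S] (X : TopCat.{u}) :=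
  ObjectProperty.FullSubcategory
    (fun E : Loganathan S ⥤ TopCat.Sheaf (Type u) X => IsPrincipal E)

/-! ### `S`-sets and universal `S`-sets -/

/-- The structure of an (effective, left) `S`-set on `Y`: a homomorphism from `S` to the symmetric
inverse semigroup of partial bijections of `Y`, such that each point lies in the domain of the
action of some `s`. The expression `y' ∈ act s y` says that `s · y` is defined and equals `y'`. -/
structure SemigroupSet (S : Type u) [InverseSemigroup S] (Y : Type u) where
  act : S → (Y ≃. Y)
  act_mul : ∀ s t : S, act (s * t) = (act t).trans (act s)
  effective : ∀ y : Y, ∃ s : S, (act s y).isSome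

section Universal

variable {S : Type u} [InverseSemigroup S]

/-- A (non-empty) filter in the semilattice of idempotents of `S`. -/
structure IsIdemFilter (F : Set S) : Prop where
  idem : ∀ e ∈ F, IsIdempotentElem e
  nonempty : F.Nonempty
  mul_mem : ∀ e ∈ F, ∀ f ∈ F, e * f ∈ F
  up_mem : ∀ e ∈ F, ∀ f : S, IsIdempotentElem f → NatLE e f → f ∈ F

/-- The set `(xH)↑`. -/
def upCoset (H : Set S) (x : S) : Set S := upClosure {a | ∃ h ∈ H, a = x * h}

/-- The cosets with respect to `H`: the sets `(xH)↑` with `𝐝(x) ∈ H`. -/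
def Cosets (H : Set S) : Type u := {A : Set S // ∃ x : S, d x ∈ H ∧ A = upCoset H x}

/-- The graph of the action of `S` on cosets: `s · (xH)↑` is defined if and only if `(sxH)↑` is a
coset, and then it equals `(sxH)↑`. -/
def CosetAct (H : Set S) (s : S) (A B : Cosets H) : Prop :=
  ∃ x : S, d x ∈ H ∧ A.1 = upCoset H x ∧ B.1 = upCoset H (s * x)

/-- An `S`-set is universal if it is equivalent to the `S`-set of cosets with respect to the closed
inverse subsemigroup `F↑` for some filter `F` of idempotents. -/
def SemigroupSet.IsUniversal {Y : Type u} (μ : SemigroupSet S Y) : Prop :=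
  ∃ F : Set S, IsIdemFilter F ∧ ∃ φ : Y ≃ Cosets (upClosure F),
    ∀ (s : S) (y y' : Y), y' ∈ μ.act s y ↔ CosetAct (upClosure F) s (φ y) (φ y')

end Universal

/-- The restriction of a partial bijection that preserves the fibres of `p` to the fibre over
`x`. -/
def stalkPEquiv {Y X : Type u} (g : Y ≃. Y) (p : Y → X)
    (hp : ∀ y y' : Y, y' ∈ g y → p y' = p y) (x : X) :
    {y : Y // p y = x} ≃. {y : Y // p y = x} where
  toFun y := (g y.1).pmap Subtype.mk (fun y' h => (hp y.1 y' h).trans y.2)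
  invFun y := (g.symm y.1).pmap Subtype.mk
    (fun y' h => (hp y' y.1 ((PEquiv.mem_iff_mem _).1 h)).symm.trans y.2)
  inv y y' := by
    simp only [Option.pmap_eq_some_iff]
    constructor
    · rintro ⟨a, _, h, ha⟩
      refine ⟨y'.1, y'.2, ?_, rfl⟩
      have : a = y.1 := (congrArg Subtype.val ha).symm
      subst this
      exact (PEquiv.mem_iff_mem _).1 h
    · rintro ⟨a, _, h, ha⟩
      refine ⟨y.1, y.2, ?_, rfl⟩
      have : a = y'.1 := (congrArg Subtype.val ha).symm
      subst this
      exact (PEquiv.mem_iff_mem _).2 h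

theorem mem_stalkPEquiv {Y X : Type u} (g : Y ≃. Y) (p : Y → X)
    (hp : ∀ y y' : Y, y' ∈ g y → p y' = p y) (x : X) (y y' : {y : Y // p y = x}) :
    y' ∈ stalkPEquiv g p hp x y ↔ y'.1 ∈ g y.1 := by
  change Option.pmap _ _ _ = some y' ↔ _
  simp only [Option.pmap_eq_some_iff]
  constructor
  · rintro ⟨a, _, h, ha⟩
    have : a = y'.1 := (congrArg Subtype.val ha).symm
    subst this
    exact h
  · intro h
    exact ⟨y'.1, y'.2, h, rfl⟩

/-- The restriction of an action with invariant fibres to the fibre over `x`. -/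
def SemigroupSet.stalk {S : Type u} [InverseSemigroup S] {Y : Type u} (μ : SemigroupSet S Y)
    {X : Type u} (p : Y → X) (hp : ∀ (s : S) (y y' : Y), y' ∈ μ.act s y → p y' = p y) (x : X) :
    SemigroupSet S {y : Y // p y = x} where
  act s := stalkPEquiv (μ.act s) p (hp s) x
  act_mul s t := by
    apply PEquiv.ext
    intro y
    apply Option.ext
    intro z
    change z ∈ stalkPEquiv _ p (hp (s * t)) x y ↔
      z ∈ (stalkPEquiv _ p (hp t) x).trans (stalkPEquiv _ p (hp s) x) y
    rw [PEquiv.mem_trans, mem_stalkPEquiv, μ.act_mul, PEquiv.mem_trans]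
    simp only [mem_stalkPEquiv]
    constructor
    · rintro ⟨b, hb, hz⟩
      exact ⟨⟨b, (hp t y.1 b hb).trans y.2⟩, hb, hz⟩
    · rintro ⟨b, hb, hz⟩
      exact ⟨b.1, hb, hz⟩
  effective y := by
    obtain ⟨s, hs⟩ := μ.effective y.1
    obtain ⟨y', hy'⟩ := Option.isSome_iff_exists.1 hs
    refine ⟨s, Option.isSome_iff_exists.2 ⟨⟨y', (hp s y.1 y' hy').trans y.2⟩, ?_⟩⟩
    exact (mem_stalkPEquiv _ p (hp s) x y _).2 hy'

/-! ### Universal `S`-sets over a space -/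

/-- A universal `S`-set in the topos of sheaves on `X`: an étale space `proj : E → X` with the
structure of an `S`-set on `E` satisfying the listed conditions. -/
structure Univ (S : Type u) [InverseSemigroup S] (X : TopCat.{u}) where
  E : Type u
  [top : TopologicalSpace E]
  proj : E → X
  isLocalHomeomorph : IsLocalHomeomorph proj
  action : SemigroupSet S E
  /-- effective on each stalk -/
  stalk_effective : ∀ x : X, ∃ e : E, proj e = x ∧ ∃ s : S, (action.act s e).isSome
  /-- domains are open -/
  isOpen_dom : ∀ s : S, IsOpen {e : E | (action.act s e).isSome}
  /-- stalks are invariant -/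
  proj_act : ∀ (s : S) (e e' : E), e' ∈ action.act s e → proj e' = proj e
  /-- universal on stalks -/
  universal : ∀ x : X, (action.stalk proj proj_act x).IsUniversal
  /-- the partially defined map `S × E → E` is continuous, where `S` is discrete -/
  continuous_act : letI : TopologicalSpace S := ⊥
    Continuous (fun p : {p : S × E // (action.act p.1 p.2).isSome} =>
      (action.act p.1.1 p.1.2).get p.2)

attribute [instance] Univ.top

namespace Univ

variable {S : Type u} [InverseSemigroup S] {X : TopCat.{u}}

/-- Morphisms are the morphisms of étale spaces that are morphisms of `S`-sets. -/
@[ext]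
structure Hom (A B : Univ S X) : Type u where
  toFun : A.E → B.E
  continuous_toFun : Continuous toFun
  proj_toFun : ∀ e : A.E, B.proj (toFun e) = A.proj e
  map_act : ∀ (s : S) (e e' : A.E), e' ∈ A.action.act s e → toFun e' ∈ B.action.act s (toFun e)

instance : Category (Univ S X) where
  Hom A B := Hom A B
  id _ := ⟨id, continuous_id, fun _ => rfl, fun _ _ _ h => h⟩
  comp f g := ⟨g.toFun ∘ f.toFun, g.continuous_toFun.comp f.continuous_toFun,
    fun e => (g.proj_toFun _).trans (f.proj_toFun e),
    fun s e e' h => g.map_act s _ _ (f.map_act s e e' h)⟩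
  id_comp _ := rfl
  comp_id _ := rfl
  assoc _ _ _ := rfl

end Univ

/-!
The equivalence is given by the functor `Univ.toPrin`, which takes a universal `S`-set `E` over `X`
to the functor that sends an idempotent `e` to the sheaf of continuous sections of the open subset
`eE ⊆ E` on which `e` is defined; an arrow `(f, s)` acts on sections by `s`. The stalk of this sheaf
at `x` is the fibre of `eE` over `x` (`Univ.stalkEquiv`), so everything can be checked on fibres.

The key to principality is an intrinsic description of universal `S`-sets: they are the non-empty,
transitive and free ones (`SemigroupSet.IsUniversal.isTransFree`,
`SemigroupSet.IsTransFree.isUniversal`). Given a base point `y₀` of such a set, the filter consists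
of the idempotents that are defined at `y₀`, and `y` corresponds to the coset `{s | s · y₀ = y}`.
On the fibre over `x`, non-emptiness, transitivity and freeness translate into the three
conditions on a principal bundle (`Univ.isPrincipal`).

A natural transformation is a compatible family of maps of the sets `eE`. These cover `E`, and two
of them that meet at a point are compared through the product of the two idempotents, so the family
glues to a map of total spaces, which is continuous because it takes local sections to local
sections. Hence `Univ.toPrin` is full and faithful.

For essential surjectivity, a principal bundle `F` gives over each point `x` the set of formal
products `m ⊗ w`, where `w` is in the stalk of `F(𝐝(m))` at `x`, modulo `m ⊗ α u ∼ n ⊗ β u` whenever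
`m α = n β` (`IsPrincipal.Tensor.Rel`); `S` acts by `s · (m ⊗ w) = s m ⊗ w` if `𝐝(s) m = m`. That
the relation is transitive uses that the bundle is transitive and free, and from this description
all properties of the action follow by computation in `S`. The sections `x ↦ e ⊗ σ_x` for `σ` a
section of `F(e)` make the union of these sets an étale space, and `y ↦ e ⊗ y` is a bijection from
the stalk of `F(e)` to the points at which `e` is defined, so that `F` is isomorphic to the bundle
of the resulting universal `S`-set (`IsPrincipal.isIso_unit`).
-/

/-! ### Inverse semigroups and cosets -/

namespace InverseSemigroup

variable {S : Type u} [InverseSemigroup S]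

theorem inv_inv' (s : S) : s⁻¹⁻¹ = s :=
  (inv_unique s⁻¹ s (inv_mul_inv s) (mul_inv_mul s)).symm

theorem mul_d (s : S) : s * d s = s := by
  unfold d; rw [← mul_assoc, mul_inv_mul]

theorem r_mul (s : S) : r s * s = s := mul_inv_mul s

theorem r_idem {e : S} (he : IsIdempotentElem e) : r e = e := by
  unfold r
  rw [inv_eq_self he]
  exact he

theorem d_mul (s t : S) : d (s * t) = t⁻¹ * d s * t := by
  unfold d; rw [mul_inv_rev']; simp only [mul_assoc]

theorem r_mul' (s t : S) : r (s * t) = s * r t * s⁻¹ := by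
  unfold r; rw [mul_inv_rev']; simp only [mul_assoc]

/-- If `𝐝(s)` absorbs `m` then `s m` has the same domain as `m`. -/
theorem d_mul_of_d_mul_eq {s m : S} (h : d s * m = m) : d (s * m) = d m := by
  rw [d_mul, mul_assoc, h]; rfl

theorem d_mul_idem (s : S) {e : S} (he : IsIdempotentElem e) : d (s * e) = d s * e := by
  rw [d_mul, inv_eq_self he, mul_assoc, ← mul_assoc, idem_comm he (isIdempotentElem_d s),
    mul_assoc, he.eq]

theorem NatLE.refl (s : S) : NatLE s s := ⟨d s, isIdempotentElem_d s, (mul_d s).symm⟩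

theorem NatLE.trans {s t v : S} (h : NatLE s t) (h' : NatLE t v) : NatLE s v := by
  obtain ⟨e, he, rfl⟩ := h
  obtain ⟨f, hf, rfl⟩ := h'
  exact ⟨f * e, isIdempotentElem_mul hf he, mul_assoc _ _ _⟩

theorem NatLE.mul_left {s t : S} (h : NatLE s t) (v : S) : NatLE (v * s) (v * t) := by
  obtain ⟨e, he, rfl⟩ := h
  exact ⟨e, he, (mul_assoc _ _ _).symm⟩

theorem mul_idem_natLE (s : S) {e : S} (he : IsIdempotentElem e) : NatLE (s * e) s :=
  ⟨e, he, rfl⟩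

theorem d_mem_of_mem_upClosure {F : Set S} (hF : IsIdemFilter F) {s : S}
    (hs : s ∈ upClosure F) : d s ∈ F := by
  obtain ⟨f, hf, e, he, rfl⟩ := hs
  have h := d_mul_idem s he
  rw [d_idem (hF.idem _ hf)] at h
  exact hF.up_mem _ hf _ (isIdempotentElem_d s) ⟨e, he, h⟩

theorem mem_upClosure_self {A : Set S} {a : S} (ha : a ∈ A) : a ∈ upClosure A :=
  ⟨a, ha, NatLE.refl a⟩

theorem d_mem_filter_of_d_mem {F : Set S} (hF : IsIdemFilter F) {x : S}
    (hx : d x ∈ upClosure F) : d x ∈ F := by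
  have := d_mem_of_mem_upClosure hF hx
  rwa [d_idem (isIdempotentElem_d x)] at this

/-- For `H = F↑` the coset `(xH)↑` is the upward closure of `xF`. -/
theorem mem_upCoset_iff {F : Set S} {x a : S} :
    a ∈ upCoset (upClosure F) x ↔ ∃ f ∈ F, NatLE (x * f) a := by
  constructor
  · rintro ⟨_, ⟨h, ⟨f, hf, hfh⟩, rfl⟩, ha⟩
    exact ⟨f, hf, (hfh.mul_left x).trans ha⟩
  · rintro ⟨f, hf, ha⟩
    exact ⟨x * f, ⟨f, mem_upClosure_self hf, rfl⟩, ha⟩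

theorem mul_upCoset_subset {F : Set S} {x y : S}
    (h : upCoset (upClosure F) x ⊆ upCoset (upClosure F) y) (s : S) :
    upCoset (upClosure F) (s * x) ⊆ upCoset (upClosure F) (s * y) := by
  intro a ha
  obtain ⟨f, hf, hfa⟩ := mem_upCoset_iff.1 ha
  obtain ⟨f', hf', hff⟩ := mem_upCoset_iff.1 (h (mem_upCoset_iff.2 ⟨f, hf, NatLE.refl (x * f)⟩))
  refine mem_upCoset_iff.2 ⟨f', hf', ?_⟩
  rw [mul_assoc] at hfa ⊢
  exact (hff.mul_left s).trans hfa

/-- Left translation of cosets is well defined. -/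
theorem mul_upCoset_congr {F : Set S} {x y : S}
    (h : upCoset (upClosure F) x = upCoset (upClosure F) y) (s : S) :
    upCoset (upClosure F) (s * x) = upCoset (upClosure F) (s * y) :=
  (mul_upCoset_subset h.subset s).antisymm (mul_upCoset_subset h.symm.subset s)

theorem upCoset_mul_idem {F : Set S} (hF : IsIdemFilter F) (x : S) {e : S} (he : e ∈ F) :
    upCoset (upClosure F) (x * e) = upCoset (upClosure F) x := by
  ext a
  rw [mem_upCoset_iff, mem_upCoset_iff]
  constructor
  · rintro ⟨f, hf, h⟩
    exact ⟨e * f, hF.mul_mem _ he _ hf, by rwa [← mul_assoc]⟩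
  · rintro ⟨f, hf, h⟩
    refine ⟨f, hf, NatLE.trans ?_ h⟩
    rw [mul_assoc, idem_comm (hF.idem _ he) (hF.idem _ hf), ← mul_assoc]
    exact mul_idem_natLE _ (hF.idem _ he)

/-- For `H = F↑`, the set `(xH)↑` is a coset only if `𝐝(x) ∈ F`. -/
theorem d_mem_of_upCoset_eq {F : Set S} (hF : IsIdemFilter F) {x y : S}
    (h : upCoset (upClosure F) x = upCoset (upClosure F) y) (hy : d y ∈ F) : d x ∈ F := by
  obtain ⟨e, he⟩ := hF.nonempty
  have hx : x * e ∈ upCoset (upClosure F) y := by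
    rw [← h]; exact mem_upCoset_iff.2 ⟨e, he, NatLE.refl _⟩
  obtain ⟨f, hf, g, hg, hfg⟩ := mem_upCoset_iff.1 hx
  have h1 := congrArg d hfg
  rw [d_mul_idem _ (hF.idem _ hf), d_mul_idem _ hg, d_mul_idem _ (hF.idem _ he), mul_assoc] at h1
  exact hF.up_mem _ (hF.mul_mem _ hy _ hf) _ (isIdempotentElem_d x)
    ⟨e * g, isIdempotentElem_mul (hF.idem _ he) hg, h1⟩

/-- Representatives of the same coset agree below some element of the filter. -/
theorem exists_mul_eq_of_upCoset_eq {F : Set S} (hF : IsIdemFilter F) {x y : S}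
    (h : upCoset (upClosure F) x = upCoset (upClosure F) y) (hy : d y ∈ F) :
    ∃ k ∈ F, x * k = y * k := by
  have hx : x ∈ upCoset (upClosure F) y := by
    rw [← h]
    have hdx := d_mem_of_upCoset_eq hF h hy
    exact mem_upCoset_iff.2 ⟨_, hdx, by rw [mul_d]; exact NatLE.refl _⟩
  obtain ⟨f, hf, g, hg, hfg⟩ := mem_upCoset_iff.1 hx
  have hk : d y * f ∈ F := hF.mul_mem _ hy _ hf
  have h1 := congrArg d hfg
  rw [d_mul_idem _ (hF.idem _ hf), d_mul_idem _ hg] at h1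
  refine ⟨d y * f, hk, ?_⟩
  have h2 : g * (d y * f) = d y * f := by
    rw [h1, ← mul_assoc, idem_comm hg (isIdempotentElem_d x), mul_assoc, hg.eq]
  calc x * (d y * f) = x * g * (d y * f) := by rw [mul_assoc, h2]
    _ = y * f * (d y * f) := by rw [hfg]
    _ = y * (d y * f) := by
      rw [mul_assoc, ← mul_assoc f, idem_comm (hF.idem _ hf) (isIdempotentElem_d y), mul_assoc,
        (hF.idem _ hf).eq]

end InverseSemigroup

/-! ### Transitive and free `S`-sets -/

namespace SemigroupSet

variable {S : Type u} [InverseSemigroup S] {Y : Type u} (μ : SemigroupSet S Y)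

theorem mem_act_mul {s t : S} {y z : Y} :
    z ∈ μ.act (s * t) y ↔ ∃ w, w ∈ μ.act t y ∧ z ∈ μ.act s w := by
  rw [μ.act_mul, PEquiv.mem_trans]

variable {μ}

theorem act_unique {s : S} {y z z' : Y} (h : z ∈ μ.act s y) (h' : z' ∈ μ.act s y) : z = z' :=
  Option.mem_unique h h'

theorem act_inj {s : S} {y y' z : Y} (h : z ∈ μ.act s y) (h' : z ∈ μ.act s y') : y = y' :=
  PEquiv.inj _ h h'

/-- Idempotents act by partial identities. -/
theorem eq_of_mem_act_idem {e : S} (he : IsIdempotentElem e) {y z : Y} (h : z ∈ μ.act e y) :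
    z = y := by
  have h' := h
  rw [← he.eq, mem_act_mul] at h'
  obtain ⟨w, hw, hz⟩ := h'
  obtain rfl := act_unique hw h
  exact act_inj hz h

theorem mem_act_inv {s : S} {y z : Y} (h : z ∈ μ.act s y) : y ∈ μ.act s⁻¹ z := by
  have h' := h
  rw [← mul_inv_mul s, mul_assoc, mem_act_mul] at h'
  obtain ⟨v, hv, hz⟩ := h'
  obtain ⟨w, hw, hvw⟩ := μ.mem_act_mul.1 hv
  obtain rfl := act_unique hw h
  rwa [act_inj hz h] at hvw

theorem mem_act_d {s : S} {y z : Y} (h : z ∈ μ.act s y) : y ∈ μ.act (d s) y :=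
  μ.mem_act_mul.2 ⟨z, h, mem_act_inv h⟩

theorem exists_mem_act_of_mem_d {s : S} {y y' : Y} (h : y' ∈ μ.act (d s) y) :
    ∃ z, z ∈ μ.act s y := by
  obtain ⟨z, hz, -⟩ := μ.mem_act_mul.1 h
  exact ⟨z, hz⟩

theorem mem_act_of_natLE {s t : S} (hst : NatLE s t) {y z : Y} (h : z ∈ μ.act s y) :
    z ∈ μ.act t y := by
  obtain ⟨e, he, rfl⟩ := hst
  obtain ⟨w, hw, hz⟩ := μ.mem_act_mul.1 h
  rwa [eq_of_mem_act_idem he hw] at hz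

theorem mem_act_mul_idem {s e : S} (he : IsIdempotentElem e) {y z : Y} :
    z ∈ μ.act (s * e) y ↔ y ∈ μ.act e y ∧ z ∈ μ.act s y := by
  rw [mem_act_mul]
  constructor
  · rintro ⟨w, hw, hz⟩
    obtain rfl := eq_of_mem_act_idem he hw
    exact ⟨hw, hz⟩
  · rintro ⟨hy, hz⟩
    exact ⟨y, hy, hz⟩

theorem mem_act_idem_mul {s e : S} (he : IsIdempotentElem e) {y z : Y} :
    z ∈ μ.act (e * s) y ↔ z ∈ μ.act e z ∧ z ∈ μ.act s y := by
  rw [mem_act_mul]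
  constructor
  · rintro ⟨w, hw, hz⟩
    obtain rfl := eq_of_mem_act_idem he hz
    exact ⟨hz, hw⟩
  · rintro ⟨hy, hz⟩
    exact ⟨z, hz, hy⟩

variable (μ)

/-- A non-empty `S`-set that is transitive and free, in the sense that two elements of `S` with the
same effect on a point agree below some idempotent that is defined at the point. -/
structure IsTransFree : Prop where
  nonempty : Nonempty Y
  trans : ∀ y z : Y, ∃ s : S, z ∈ μ.act s y
  free : ∀ (s t : S) (y z : Y), z ∈ μ.act s y → z ∈ μ.act t y →
    ∃ e : S, IsIdempotentElem e ∧ y ∈ μ.act e y ∧ s * e = t * e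

variable {μ}

theorem IsUniversal.isTransFree (h : μ.IsUniversal) : μ.IsTransFree := by
  obtain ⟨F, hF, φ, hφ⟩ := h
  have rep : ∀ A : Cosets (upClosure F), ∃ x, d x ∈ F ∧ A.1 = upCoset (upClosure F) x := by
    rintro ⟨A, x, hx, rfl⟩
    exact ⟨x, d_mem_filter_of_d_mem hF hx, rfl⟩
  refine ⟨?_, fun y z => ?_, fun s t y z hs ht => ?_⟩
  · obtain ⟨e, he⟩ := hF.nonempty
    refine ⟨φ.symm ⟨upCoset (upClosure F) e, e, ?_, rfl⟩⟩
    rw [d_idem (hF.idem _ he)]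
    exact mem_upClosure_self he
  · obtain ⟨x, hx, hxy⟩ := rep (φ y)
    obtain ⟨x', hx', hxz⟩ := rep (φ z)
    refine ⟨x' * x⁻¹, (hφ _ _ _).2 ⟨x, mem_upClosure_self hx, hxy, ?_⟩⟩
    rw [hxz, mul_assoc]
    exact (upCoset_mul_idem hF x' hx).symm
  · obtain ⟨x, hx, hxy, hxz⟩ := (hφ _ _ _).1 hs
    obtain ⟨x', hx', hxy', hxz'⟩ := (hφ _ _ _).1 ht
    obtain ⟨z', hz', hzz'⟩ := rep (φ z)
    replace hx := d_mem_filter_of_d_mem hF hx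
    rw [← mul_upCoset_congr (hxy.symm.trans hxy') t] at hxz'
    have hd : d (t * x) ∈ F := d_mem_of_upCoset_eq hF (hxz'.symm.trans hzz') hz'
    obtain ⟨k, hk, hkk⟩ := exists_mul_eq_of_upCoset_eq hF (hxz.symm.trans hxz') hd
    -- the idempotent `x k x⁻¹` fixes the coset of `x`, because `k` lies in the filter
    have hke := hF.idem _ hk
    have hee : x * k * x⁻¹ = r (x * k) := by rw [r_mul', r_idem hke]
    have he : IsIdempotentElem (x * k * x⁻¹) := by rw [hee]; exact isIdempotentElem_r _
    refine ⟨x * k * x⁻¹, he, (hφ _ _ _).2 ⟨x, mem_upClosure_self hx, hxy, ?_⟩, ?_⟩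
    · rw [hxy, mul_assoc, mul_assoc]
      exact (upCoset_mul_idem hF x (hF.mul_mem _ hk _ hx)).symm
    · simp only [mul_assoc] at hkk ⊢
      rw [← mul_assoc x k, ← mul_assoc s, ← mul_assoc t]
      rw [hkk]

/-- The coset model of a transitive and free `S`-set: with respect to a base point `y₀` the filter
consists of the idempotents that are defined at `y₀`, and the point `y` corresponds to the coset
`{s | s · y₀ = y}`. -/
theorem IsTransFree.isUniversal (h : μ.IsTransFree) : μ.IsUniversal := by
  obtain ⟨y₀⟩ := h.nonempty
  let F : Set S := {e | IsIdempotentElem e ∧ y₀ ∈ μ.act e y₀}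
  have hF : IsIdemFilter F := by
    refine ⟨fun e he => he.1, ?_, fun e he f hf => ?_, fun e he f hf hef => ?_⟩
    · obtain ⟨s, hs⟩ := μ.effective y₀
      obtain ⟨z, hz⟩ := Option.isSome_iff_exists.1 hs
      exact ⟨d s, isIdempotentElem_d s, mem_act_d hz⟩
    · exact ⟨isIdempotentElem_mul he.1 hf.1, (mem_act_mul_idem hf.1).2 ⟨hf.2, he.2⟩⟩
    · exact ⟨hf, mem_act_of_natLE hef he.2⟩
  have coset : ∀ (x : S) (y : Y), y ∈ μ.act x y₀ →
      upCoset (upClosure F) x = {s | y ∈ μ.act s y₀} := by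
    intro x y hxy
    ext s
    rw [mem_upCoset_iff]
    constructor
    · rintro ⟨f, hf, hfs⟩
      exact mem_act_of_natLE hfs ((mem_act_mul_idem hf.1).2 ⟨hf.2, hxy⟩)
    · intro hs
      obtain ⟨e, he, hy, hxe⟩ := h.free x s y₀ y hxy hs
      exact ⟨e, ⟨he, hy⟩, e, he, hxe⟩
  have defined : ∀ x : S, d x ∈ upClosure F → ∃ y, y ∈ μ.act x y₀ := fun x hx =>
    exists_mem_act_of_mem_d (d_mem_filter_of_d_mem hF hx).2
  have dmem : ∀ (x : S) (y : Y), y ∈ μ.act x y₀ → d x ∈ upClosure F := fun x y hxy =>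
    mem_upClosure_self ⟨isIdempotentElem_d x, mem_act_d hxy⟩
  let φ : Y → Cosets (upClosure F) := fun y => ⟨{s | y ∈ μ.act s y₀}, by
    obtain ⟨x, hx⟩ := h.trans y₀ y
    exact ⟨x, dmem x y hx, (coset x y hx).symm⟩⟩
  have hφ : Function.Bijective φ := by
    constructor
    · intro y z hyz
      obtain ⟨x, hx⟩ := h.trans y₀ y
      have hz : x ∈ {s | z ∈ μ.act s y₀} := by
        have hyz' : {s | y ∈ μ.act s y₀} = {s | z ∈ μ.act s y₀} := congrArg Subtype.val hyz
        exact hyz' ▸ hx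
      exact act_unique hx hz
    · rintro ⟨A, x, hx, rfl⟩
      obtain ⟨y, hy⟩ := defined x hx
      exact ⟨y, Subtype.ext (coset x y hy).symm⟩
  refine ⟨F, hF, Equiv.ofBijective φ hφ, fun s y y' => ?_⟩
  constructor
  · intro hs
    obtain ⟨x, hx⟩ := h.trans y₀ y
    exact ⟨x, dmem x y hx, (coset x y hx).symm,
      (coset (s * x) y' (μ.mem_act_mul.2 ⟨y, hx, hs⟩)).symm⟩
  · rintro ⟨x, hx, hy, hy'⟩
    obtain ⟨w, hw⟩ := defined x hx
    obtain rfl : w = y := hφ.1 (Subtype.ext ((coset x w hw).symm.trans hy.symm))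
    obtain ⟨e, he⟩ := hF.nonempty
    have hsx : s * x * e ∈ {s | y' ∈ μ.act s y₀} := by
      change s * x * e ∈ ((Equiv.ofBijective φ hφ) y').1
      rw [hy']
      exact mem_upCoset_iff.2 ⟨e, he, NatLE.refl _⟩
    obtain ⟨v, hv, hy'⟩ := μ.mem_act_mul.1 ((mem_act_mul_idem he.1).1 hsx).2
    obtain rfl := act_unique hv hw
    exact hy'

end SemigroupSet

namespace Loganathan

variable {S : Type u} [InverseSemigroup S]

/-- The element of `S` underlying an arrow of Loganathan's category. -/
def val {e f : Loganathan S} (α : e ⟶ f) : S := Hom.elt α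

theorem hom_ext {e f : Loganathan S} {α β : e ⟶ f} (h : val α = val β) : α = β := Hom.ext h

@[simp] theorem val_id (e : Loganathan S) : val (𝟙 e) = e.idem := rfl

@[simp] theorem val_comp {e f g : Loganathan S} (α : e ⟶ f) (β : f ⟶ g) :
    val (α ≫ β) = val β * val α := rfl

theorem d_val {e f : Loganathan S} (α : e ⟶ f) : d (val α) = e.idem := Hom.d_elt α

theorem mul_val {e f : Loganathan S} (α : e ⟶ f) : f.idem * val α = val α := Hom.mul_elt α

/-- The arrow `(f, s) : 𝐝(s) ⟶ f`, for any name `e` of the object `𝐝(s)`. -/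
def arr {e : Loganathan S} (s : S) (hs : d s = e.idem) (f : Loganathan S)
    (hf : f.idem * s = s) : e ⟶ f := (⟨s, hs, hf⟩ : Hom e f)

@[simp] theorem val_arr {e : Loganathan S} (s : S) (hs : d s = e.idem) (f : Loganathan S)
    (hf : f.idem * s = s) : val (arr s hs f hf) = s := rfl

end Loganathan

open Loganathan

/-! ### Sheaves of sections of a universal `S`-set over a space -/

theorem sheaf_hom_ext {X : TopCat.{u}} {F G : TopCat.Sheaf (Type u) X} {f g : F ⟶ G}
    (h : ∀ (U : Opens X) (σ : F.presheaf.obj (.op U)),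
      f.hom.app (.op U) σ = g.hom.app (.op U) σ) : f = g := by
  apply Sheaf.hom_ext
  ext U σ
  exact h U.unop σ

namespace Univ

variable {S : Type u} [InverseSemigroup S] {X : TopCat.{u}} (A : Univ S X)

/-- The part of the fibre over `x` on which the idempotent `e` is defined. -/
abbrev Fib (e : Loganathan S) (x : X) : Type u :=
  {y : A.E // A.proj y = x ∧ y ∈ A.action.act e.idem y}

theorem mem_act_idem_iff {e : S} (he : IsIdempotentElem e) (y : A.E) :
    y ∈ A.action.act e y ↔ (A.action.act e y).isSome := by
  rw [Option.isSome_iff_exists]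
  constructor
  · exact fun h => ⟨y, h⟩
  · rintro ⟨z, hz⟩
    exact SemigroupSet.eq_of_mem_act_idem he hz ▸ hz

theorem isOpen_idem (e : Loganathan S) : IsOpen {y : A.E | y ∈ A.action.act e.idem y} := by
  simp only [A.mem_act_idem_iff e.isIdem]
  exact A.isOpen_dom e.idem

variable {A} in
theorem exists_mem_act {e f : Loganathan S} (α : e ⟶ f) {x : X} (y : A.Fib e x) :
    ∃ z, z ∈ A.action.act (val α) y.1 :=
  SemigroupSet.exists_mem_act_of_mem_d (by rw [d_val]; exact y.2.2)

variable {A} in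
/-- The action of an arrow `e ⟶ f` of Loganathan's category on the points of a fibre at which
`e` is defined. -/
noncomputable def fibAct {e f : Loganathan S} (α : e ⟶ f) {x : X} (y : A.Fib e x) : A.Fib f x :=
  ⟨(A.action.act (val α) y.1).get (Option.isSome_iff_exists.2 (exists_mem_act α y)), by
    have h : (A.action.act (val α) y.1).get (Option.isSome_iff_exists.2 (exists_mem_act α y)) ∈
      A.action.act (val α) y.1 := Option.get_mem _
    refine ⟨(A.proj_act _ _ _ h).trans y.2.1, ?_⟩
    have h' := h
    generalize (A.action.act (val α) y.1).get _ = z at h'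
    rw [← mul_val α] at h'
    exact ((SemigroupSet.mem_act_idem_mul f.isIdem).1 h').1⟩

variable {A} in
theorem fibAct_mem {e f : Loganathan S} (α : e ⟶ f) {x : X} (y : A.Fib e x) :
    (fibAct α y).1 ∈ A.action.act (val α) y.1 := Option.get_mem _

variable {A} in
theorem fibAct_eq_iff {e f : Loganathan S} (α : e ⟶ f) {x : X} (y : A.Fib e x) (z : A.Fib f x) :
    fibAct α y = z ↔ z.1 ∈ A.action.act (val α) y.1 := by
  constructor
  · rintro rfl
    exact fibAct_mem α y
  · intro h
    exact Subtype.ext (SemigroupSet.act_unique (fibAct_mem α y) h)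

/-- The action of each single element is continuous on its domain. -/
theorem continuous_act_elt (s : S) :
    Continuous (fun y : {y : A.E // (A.action.act s y).isSome} =>
      (A.action.act s y.1).get y.2) := by
  let _ : TopologicalSpace S := ⊥
  have h := A.continuous_act
  have hi : Continuous (fun y : {y : A.E // (A.action.act s y).isSome} =>
      (⟨(s, y.1), y.2⟩ : {p : S × A.E // (A.action.act p.1 p.2).isSome})) := by
    fun_prop
  exact h.comp hi

/-- Being a continuous section of the étale space, with values in the domain of `e`. -/
def secPred (e : Loganathan S) : TopCat.LocalPredicate (A.Fib e) where
  pred {U} f := Continuous (fun x : U => (f x).1)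
  res {_ _} i _ h := h.comp (Opens.isOpenEmbedding_of_le i.le).continuous
  locality {U} f w := by
    apply continuous_iff_continuousAt.2
    intro x
    obtain ⟨V, m, i, hc⟩ := w x
    have hc' := continuous_iff_continuousAt.1 hc ⟨x, m⟩
    exact ((Opens.isOpenEmbedding_of_le i.le).continuousAt_iff
      (g := fun x : U => (f x).1) (x := ⟨x.1, m⟩)).1 hc'

/-- The functor on Loganathan's category that takes an idempotent `e` to the sheaf of sections of
the open subset `eE` of the étale space `E`. -/
noncomputable def toFunctor : Loganathan S ⥤ TopCat.Sheaf (Type u) X where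
  obj e := TopCat.subsheafToTypes (A.secPred e)
  map {e f} α := ⟨{
    app U := ↾fun σ => ⟨fun x => fibAct α (σ.1 x),
      (A.continuous_act_elt (val α)).comp
        (σ.2.subtype_mk fun x => Option.isSome_iff_exists.2 (exists_mem_act α (σ.1 x)))⟩
    naturality _ _ _ := rfl }⟩
  map_id e := by
    refine sheaf_hom_ext fun U σ => Subtype.ext (funext fun x => ?_)
    exact (fibAct_eq_iff _ _ _).2 (σ.1 x).2.2
  map_comp {e f g} α β := by
    refine sheaf_hom_ext fun U σ => Subtype.ext (funext fun x => ?_)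
    refine (fibAct_eq_iff (α ≫ β) _ _).2 ?_
    rw [val_comp, SemigroupSet.mem_act_mul]
    exact ⟨_, fibAct_mem α _, fibAct_mem β _⟩

/-- Through every point of `eE` there is a continuous local section of `eE`. -/
theorem exists_section (e : Loganathan S) {x : X} (y : A.Fib e x) :
    ∃ (U : Opens X) (hx : x ∈ U) (f : ∀ z : U, A.Fib e z),
      (A.secPred e).pred f ∧ f ⟨x, hx⟩ = y := by
  obtain ⟨y, rfl, hy⟩ := y
  obtain ⟨g, hyg, hg⟩ := A.isLocalHomeomorph y
  have hop := A.isOpen_idem e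
  have hsrc : ∀ z ∈ g.target, A.proj (g.symm z) = z := fun z hz => by
    rw [hg]; exact g.right_inv hz
  have hy' : g.symm (A.proj y) = y := by rw [hg]; exact g.left_inv hyg
  let U : Opens X := ⟨g.target ∩ g.symm ⁻¹' {y : A.E | y ∈ A.action.act e.idem y},
    g.symm.isOpen_inter_preimage hop⟩
  refine ⟨U, ⟨?_, ?_⟩, fun z => ⟨g.symm z, hsrc z z.2.1, z.2.2⟩, ?_, ?_⟩
  · rw [hg]; exact g.map_source hyg
  · change g.symm (A.proj y) ∈ {y : A.E | y ∈ A.action.act e.idem y}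
    rw [hy']
    exact hy
  · exact continuousOn_iff_continuous_domRestrict.1 (g.continuousOn_symm.mono fun z hz => hz.1)
  · exact Subtype.ext hy'

/-- Continuous local sections that agree at a point agree nearby. -/
theorem exists_eq_of_sections {U V : Opens X} {x : X} (hU : x ∈ U) (hV : x ∈ V)
    (f : U → A.E) (g : V → A.E) (hf : Continuous f) (hg : Continuous g)
    (pf : ∀ z, A.proj (f z) = z) (pg : ∀ z, A.proj (g z) = z) (h : f ⟨x, hU⟩ = g ⟨x, hV⟩) :
    ∃ (W : Opens X) (_ : x ∈ W) (hWU : W ≤ U) (hWV : W ≤ V),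
      ∀ z (hz : z ∈ W), f ⟨z, hWU hz⟩ = g ⟨z, hWV hz⟩ := by
  obtain ⟨N, hN, hfN, hinj⟩ := A.isLocalHomeomorph.isLocallyInjective (f ⟨x, hU⟩)
  refine ⟨⟨Subtype.val '' (f ⁻¹' N) ∩ Subtype.val '' (g ⁻¹' N),
      (U.isOpen.isOpenMap_subtype_val _ (hN.preimage hf)).inter
        (V.isOpen.isOpenMap_subtype_val _ (hN.preimage hg))⟩,
    ⟨⟨_, hfN, rfl⟩, ⟨⟨x, hV⟩, (h ▸ hfN : g ⟨x, hV⟩ ∈ N), rfl⟩⟩, ?_, ?_, ?_⟩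
  · rintro _ ⟨⟨z, -, rfl⟩, -⟩
    exact z.2
  · rintro _ ⟨-, ⟨z, -, rfl⟩⟩
    exact z.2
  · rintro z ⟨⟨z₁, h₁, e₁⟩, ⟨z₂, h₂, e₂⟩⟩
    have h₁' : f ⟨z, e₁ ▸ z₁.2⟩ ∈ N := (Subtype.ext e₁ : z₁ = ⟨z, e₁ ▸ z₁.2⟩) ▸ h₁
    have h₂' : g ⟨z, e₂ ▸ z₂.2⟩ ∈ N := (Subtype.ext e₂ : z₂ = ⟨z, e₂ ▸ z₂.2⟩) ▸ h₂
    exact hinj h₁' h₂' ((pf ⟨z, _⟩).trans (pg ⟨z, _⟩).symm)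

theorem stalkToFiber_bijective (e : Loganathan S) (x : X) :
    Function.Bijective (TopCat.stalkToFiber (A.secPred e) x) := by
  constructor
  · apply TopCat.stalkToFiber_injective
    intro U V fU hU fV hV h
    obtain ⟨W, hx, hWU, hWV, heq⟩ := A.exists_eq_of_sections U.2 V.2 (fun z => (fU z).1)
      (fun z => (fV z).1) hU hV (fun z => (fU z).2.1) (fun z => (fV z).2.1)
      (congrArg Subtype.val h)
    exact ⟨⟨W, hx⟩, homOfLE hWU, homOfLE hWV, fun w => Subtype.ext (heq w.1 w.2)⟩
  · apply TopCat.stalkToFiber_surjective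
    intro t
    obtain ⟨U, hx, f, hf, rfl⟩ := A.exists_section e t
    exact ⟨⟨U, hx⟩, f, hf, rfl⟩

/-- The stalk at `x` of the sheaf of sections of `eE` is the fibre of `eE` over `x`. -/
noncomputable def stalkEquiv (e : Loganathan S) (x : X) :
    bundleStalk A.toFunctor x e ≃ A.Fib e x :=
  Equiv.ofBijective _ (A.stalkToFiber_bijective e x)

theorem stalkEquiv_germ (e : Loganathan S) {U : Opens X} {x : X} (hx : x ∈ U)
    (σ : (A.toFunctor.obj e).presheaf.obj (.op U)) :
    A.stalkEquiv e x ((A.toFunctor.obj e).presheaf.germ U x hx σ) = σ.1 ⟨x, hx⟩ :=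
  TopCat.stalkToFiber_germ _ _ _ _ _

theorem stalkEquiv_bundleAct {e f : Loganathan S} (α : e ⟶ f) (x : X)
    (y : bundleStalk A.toFunctor x e) :
    A.stalkEquiv f x (bundleAct A.toFunctor x α y) = fibAct α (A.stalkEquiv e x y) := by
  obtain ⟨U, hx, σ, rfl⟩ := (A.toFunctor.obj e).presheaf.exists_germ_eq y
  rw [stalkEquiv_germ]
  unfold bundleAct
  rw [TopCat.Presheaf.stalkFunctor_map_germ_apply]
  exact A.stalkEquiv_germ f hx _

theorem isTransFree (x : X) : (A.action.stalk A.proj A.proj_act x).IsTransFree :=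
  (A.universal x).isTransFree

theorem mem_stalk_act {x : X} {s : S} {y z : {y : A.E // A.proj y = x}} :
    z ∈ (A.action.stalk A.proj A.proj_act x).act s y ↔ z.1 ∈ A.action.act s y.1 :=
  mem_stalkPEquiv _ _ (A.proj_act s) _ _ _

theorem isPrincipal : IsPrincipal A.toFunctor where
  nonempty x := by
    obtain ⟨y, rfl, s, hs⟩ := A.stalk_effective x
    obtain ⟨z, hz⟩ := Option.isSome_iff_exists.1 hs
    exact ⟨⟨d s, isIdempotentElem_d s⟩,
      ⟨(A.stalkEquiv _ _).symm ⟨y, rfl, SemigroupSet.mem_act_d hz⟩⟩⟩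
  transitive x e f y z := by
    -- if `s · y = z` then both points come from `y` in the domain of `f s e`
    have hy := (A.stalkEquiv e x y).2
    have hz := (A.stalkEquiv f x z).2
    obtain ⟨s, hs⟩ := (A.isTransFree x).trans ⟨(A.stalkEquiv e x y).1, hy.1⟩
      ⟨(A.stalkEquiv f x z).1, hz.1⟩
    rw [mem_stalk_act] at hs
    have ht : (A.stalkEquiv f x z).1 ∈ A.action.act (f.idem * (s * e.idem))
        (A.stalkEquiv e x y).1 :=
      (SemigroupSet.mem_act_idem_mul f.isIdem).2
        ⟨hz.2, (SemigroupSet.mem_act_mul_idem e.isIdem).2 ⟨hy.2, hs⟩⟩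
    generalize htt : f.idem * (s * e.idem) = t at ht
    let b : Loganathan S := ⟨d t, isIdempotentElem_d t⟩
    have hbe : e.idem * d t = d t := by
      rw [← htt, ← mul_assoc, d_mul_idem _ e.isIdem, idem_comm e.isIdem
        (isIdempotentElem_mul (isIdempotentElem_d _) e.isIdem), mul_assoc, e.isIdem.eq]
    have hft : f.idem * t = t := by rw [← htt, ← mul_assoc, f.isIdem.eq]
    let w : A.Fib b x := ⟨(A.stalkEquiv e x y).1, hy.1, SemigroupSet.mem_act_d ht⟩
    refine ⟨b, arr (d t) (d_idem b.isIdem) e hbe, arr t rfl f hft, (A.stalkEquiv b x).symm w,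
      ?_, ?_⟩
    · apply (A.stalkEquiv e x).injective
      rw [stalkEquiv_bundleAct, Equiv.apply_symm_apply, fibAct_eq_iff]
      exact w.2.2
    · apply (A.stalkEquiv f x).injective
      rw [stalkEquiv_bundleAct, Equiv.apply_symm_apply, fibAct_eq_iff]
      exact ht
  free x e f α β y h := by
    have hy := (A.stalkEquiv e x y).2
    have hα := A.stalkEquiv_bundleAct α x y
    have hβ := A.stalkEquiv_bundleAct β x y
    rw [h] at hα
    rw [eq_comm, fibAct_eq_iff] at hα hβ
    have hz := (A.stalkEquiv f x (bundleAct A.toFunctor x β y)).2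
    obtain ⟨k, hk, hky, hkk⟩ := (A.isTransFree x).free (val α) (val β)
      ⟨_, hy.1⟩ ⟨_, hz.1⟩ (A.mem_stalk_act.2 hα) (A.mem_stalk_act.2 hβ)
    rw [mem_stalk_act] at hky
    let b : Loganathan S := ⟨e.idem * k, isIdempotentElem_mul e.isIdem hk⟩
    have hw : (A.stalkEquiv e x y).1 ∈ A.action.act b.idem (A.stalkEquiv e x y).1 :=
      (SemigroupSet.mem_act_mul_idem hk).2 ⟨hky, hy.2⟩
    let w : A.Fib b x := ⟨(A.stalkEquiv e x y).1, hy.1, hw⟩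
    refine ⟨b, arr b.idem (d_idem b.isIdem) e ?_, (A.stalkEquiv b x).symm w, ?_, ?_⟩
    · change e.idem * (e.idem * k) = e.idem * k
      rw [← mul_assoc, e.isIdem.eq]
    · apply hom_ext
      simp only [val_comp, val_arr]
      change val α * (e.idem * k) = val β * (e.idem * k)
      rw [idem_comm e.isIdem hk, ← mul_assoc, hkk, mul_assoc]
    · apply (A.stalkEquiv e x).injective
      rw [stalkEquiv_bundleAct, Equiv.apply_symm_apply, fibAct_eq_iff]
      exact hw

end Univ

/-! ### Morphisms and natural transformations -/

namespace Univ

variable {S : Type u} [InverseSemigroup S] {X : TopCat.{u}} {A B : Univ S X}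

variable (A) in
/-- The continuous sections of `eE` over `U`. -/
abbrev Sec (e : Loganathan S) (U : Opens X) : Type u :=
  {f : ∀ x : U, A.Fib e x // (A.secPred e).pred f}

/-- The map on the fibres of `eE` that is induced by a morphism. -/
def Hom.fibMap (φ : Hom A B) {e : Loganathan S} {x : X} (y : A.Fib e x) : B.Fib e x :=
  ⟨φ.toFun y.1, (φ.proj_toFun _).trans y.2.1, φ.map_act _ _ _ y.2.2⟩

/-- A morphism of universal `S`-sets over `X` acts on sections by composition. -/
def Hom.toNatTrans (φ : Hom A B) : A.toFunctor ⟶ B.toFunctor where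
  app e := ⟨{
    app U := ↾fun σ => ⟨fun x => φ.fibMap (σ.1 x), φ.continuous_toFun.comp σ.2⟩
    naturality _ _ _ := rfl }⟩
  naturality e f α := by
    refine sheaf_hom_ext fun U σ => Subtype.ext (funext fun x => ?_)
    exact ((fibAct_eq_iff α _ _).2 (φ.map_act _ _ _ (fibAct_mem α (σ.1 x)))).symm

/-- The functor that takes a universal `S`-set `E` over `X` to the principal bundle formed by the
sheaves of sections of the open subsets `eE`. -/
noncomputable def toPrin (S : Type u) [InverseSemigroup S] (X : TopCat.{u}) :
    Univ S X ⥤ Prin S X where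
  obj A := ⟨A.toFunctor, A.isPrincipal⟩
  map φ := ⟨Hom.toNatTrans φ⟩
  map_id _ := rfl
  map_comp _ _ := rfl

variable (A) in
/-- Each point of `E` is a point of `eE` for some idempotent `e`. -/
theorem exists_idem (y : A.E) : ∃ e : Loganathan S, y ∈ A.action.act e.idem y := by
  obtain ⟨s, hs⟩ := A.action.effective y
  obtain ⟨z, hz⟩ := Option.isSome_iff_exists.1 hs
  exact ⟨⟨d s, isIdempotentElem_d s⟩, SemigroupSet.mem_act_d hz⟩

section Full

variable (η : A.toFunctor ⟶ B.toFunctor)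

/-- The map on fibres that is induced by a natural transformation. -/
noncomputable def fibTrans {e : Loganathan S} {x : X} (y : A.Fib e x) : B.Fib e x :=
  B.stalkEquiv e x ((TopCat.Presheaf.stalkFunctor (Type u) x).map (η.app e).hom
    ((A.stalkEquiv e x).symm y))

theorem fibTrans_section {e : Loganathan S} {U : Opens X} (x : U)
    (σ : (A.toFunctor.obj e).presheaf.obj (.op U)) :
    fibTrans η (σ.1 x) =
      ((η.app e).hom.app (.op U) σ : B.Sec e U).1 x := by
  have h : (A.stalkEquiv e x).symm (σ.1 x) = (A.toFunctor.obj e).presheaf.germ U x.1 x.2 σ := by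
    rw [Equiv.symm_apply_eq, stalkEquiv_germ]
  unfold fibTrans
  rw [h, TopCat.Presheaf.stalkFunctor_map_germ_apply]
  exact B.stalkEquiv_germ e x.2 _

theorem fibTrans_fibAct {e f : Loganathan S} (α : e ⟶ f) {x : X} (y : A.Fib e x) :
    fibTrans η (fibAct α y) = fibAct α (fibTrans η y) := by
  obtain ⟨U, hx, σ, hσ, rfl⟩ := A.exists_section e y
  have h1 := fibTrans_section η ⟨x, hx⟩ (⟨σ, hσ⟩ : A.Sec e U)
  have h2 := fibTrans_section η ⟨x, hx⟩ ((A.toFunctor.map α).hom.app (.op U)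
    (⟨σ, hσ⟩ : A.Sec e U))
  have h3 := congrArg (fun τ : A.toFunctor.obj e ⟶ B.toFunctor.obj f =>
    (τ.hom.app (.op U) (⟨σ, hσ⟩ : A.Sec e U) :
      B.Sec f U).1 ⟨x, hx⟩) (η.naturality α)
  exact (h2.trans h3).trans (congrArg (fibAct α) h1.symm)

theorem fibTrans_val_of_le {e f : Loganathan S} (hef : f.idem * e.idem = e.idem) {x x' : X}
    (y : A.Fib e x) (z : A.Fib f x') (hyz : y.1 = z.1) :
    (fibTrans η y).1 = (fibTrans η z).1 := by
  obtain rfl : x = x' := by rw [← y.2.1, ← z.2.1, hyz]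
  let i : e ⟶ f := arr e.idem (d_idem e.isIdem) f hef
  have h : fibAct i y = z := (fibAct_eq_iff _ _ _).2 (hyz ▸ y.2.2)
  rw [← h, fibTrans_fibAct]
  exact (SemigroupSet.eq_of_mem_act_idem e.isIdem (fibAct_mem i (fibTrans η y))).symm

/-- The map on fibres does not depend on the chosen idempotent: pass to the product of two. -/
theorem fibTrans_val {e f : Loganathan S} {x x' : X}
    (y : A.Fib e x) (z : A.Fib f x') (hyz : y.1 = z.1) :
    (fibTrans η y).1 = (fibTrans η z).1 := by
  let b : Loganathan S := ⟨e.idem * f.idem, isIdempotentElem_mul e.isIdem f.isIdem⟩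
  let w : A.Fib b x := ⟨y.1, y.2.1,
    (SemigroupSet.mem_act_mul_idem f.isIdem).2 ⟨hyz ▸ z.2.2, y.2.2⟩⟩
  rw [← fibTrans_val_of_le η (e := b) (f := e) ?_ w y rfl,
    ← fibTrans_val_of_le η (e := b) (f := f) ?_ w z hyz]
  · change f.idem * (e.idem * f.idem) = e.idem * f.idem
    rw [idem_comm e.isIdem f.isIdem, ← mul_assoc, f.isIdem.eq]
  · change e.idem * (e.idem * f.idem) = e.idem * f.idem
    rw [← mul_assoc, e.isIdem.eq]

/-- The map of total spaces that is induced by a natural transformation. -/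
noncomputable def totalMap (y : A.E) : B.E :=
  (fibTrans η (⟨y, rfl, (A.exists_idem y).choose_spec⟩ :
    A.Fib (A.exists_idem y).choose (A.proj y))).1

theorem totalMap_fib {e : Loganathan S} {x : X} (y : A.Fib e x) :
    totalMap η y.1 = (fibTrans η y).1 := fibTrans_val η _ _ rfl

variable (A) in
theorem isOpenEmbedding_section {e : Loganathan S} {U : Opens X} (σ : ∀ z : U, A.Fib e z)
    (hσ : (A.secPred e).pred σ) :
    Topology.IsOpenEmbedding (fun z : U => (σ z).1) := by
  refine A.isLocalHomeomorph.isOpenEmbedding_of_comp ?_ hσ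
  have h : A.proj ∘ (fun z : U => (σ z).1) = Subtype.val := funext fun z => (σ z).2.1
  rw [h]
  exact U.isOpen.isOpenEmbedding_subtypeVal

theorem continuous_totalMap : Continuous (totalMap η) := by
  rw [continuous_iff_continuousAt]
  intro y
  obtain ⟨e, he⟩ := A.exists_idem y
  obtain ⟨U, hx, σ, hσ, hσx⟩ := A.exists_section e ⟨y, rfl, he⟩
  have hy : (σ ⟨_, hx⟩).1 = y := congrArg Subtype.val hσx
  rw [← hy, ← (A.isOpenEmbedding_section σ hσ).continuousAt_iff (x := ⟨_, hx⟩)]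
  have h : totalMap η ∘ (fun z : U => (σ z).1) = fun z =>
      (((η.app e).hom.app (.op U) (⟨σ, hσ⟩ : A.Sec e U) :
        B.Sec e U).1 z).1 := funext fun z =>
    (totalMap_fib η (σ z)).trans (congrArg Subtype.val (fibTrans_section η z
      (⟨σ, hσ⟩ : A.Sec e U)))
  rw [h]
  exact Continuous.continuousAt (Subtype.property
    ((η.app e).hom.app (.op U) (⟨σ, hσ⟩ : A.Sec e U) :
        B.Sec e U))

/-- The morphism of universal `S`-sets over `X` that is induced by a natural transformation. -/
noncomputable def homOfNatTrans : Hom A B where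
  toFun := totalMap η
  continuous_toFun := continuous_totalMap η
  proj_toFun y := (fibTrans η _).2.1
  map_act s y z h := by
    let e : Loganathan S := ⟨d s, isIdempotentElem_d s⟩
    let f : Loganathan S := ⟨r s, isIdempotentElem_r s⟩
    let α : e ⟶ f := arr s rfl f (r_mul s)
    let y' : A.Fib e (A.proj y) := ⟨y, rfl, SemigroupSet.mem_act_d h⟩
    have hz : (fibAct α y').1 = z := SemigroupSet.act_unique (fibAct_mem α y') h
    rw [← hz, totalMap_fib, fibTrans_fibAct, show totalMap η y = _ from totalMap_fib η y']
    exact fibAct_mem α (fibTrans η y')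

theorem toNatTrans_homOfNatTrans : (homOfNatTrans η).toNatTrans = η := by
  ext e
  refine sheaf_hom_ext fun U σ => Subtype.ext (funext fun x => ?_)
  exact Subtype.ext ((totalMap_fib η (σ.1 x)).trans
    (congrArg Subtype.val (fibTrans_section η x σ)))

end Full

instance : (toPrin S X).Full where
  map_surjective η := ⟨homOfNatTrans η.hom,
    InducedCategory.hom_ext (toNatTrans_homOfNatTrans η.hom)⟩

instance : (toPrin S X).Faithful where
  map_injective {A B φ ψ} h := by
    apply Hom.ext
    funext y
    obtain ⟨e, he⟩ := A.exists_idem y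
    obtain ⟨U, hx, σ, hσ, hσx⟩ := A.exists_section e ⟨y, rfl, he⟩
    have h' := congrArg (fun η : A.toFunctor ⟶ B.toFunctor =>
      ((η.app e).hom.app (.op U) (⟨σ, hσ⟩ : A.Sec e U) :
        B.Sec e U).1 ⟨_, hx⟩) (congrArg (·.hom) h)
    have hy : (σ ⟨_, hx⟩).1 = y := congrArg Subtype.val hσx
    have h'' := congrArg Subtype.val h'
    change φ.toFun (σ ⟨_, hx⟩).1 = ψ.toFun (σ ⟨_, hx⟩).1 at h''
    rwa [hy] at h''

end Univ

/-! ### Stalk maps of a bundle -/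

section BundleAct

variable {C : Type u} [SmallCategory C] {X : TopCat.{u}} (F : C ⥤ TopCat.Sheaf (Type u) X)

theorem bundleAct_comp {x : X} {b c d : C} (α : b ⟶ c) (β : c ⟶ d) (y : bundleStalk F x b) :
    bundleAct F x (α ≫ β) y = bundleAct F x β (bundleAct F x α y) := by
  have h : (F.map (α ≫ β)).hom = (F.map α).hom ≫ (F.map β).hom := by
    rw [F.map_comp]; rfl
  unfold bundleAct
  rw [h, Functor.map_comp]
  rfl

theorem bundleAct_id {x : X} {c : C} (y : bundleStalk F x c) : bundleAct F x (𝟙 c) y = y := by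
  have h : (F.map (𝟙 c)).hom = 𝟙 (F.obj c).presheaf := by
    rw [F.map_id]; rfl
  unfold bundleAct
  rw [h, CategoryTheory.Functor.map_id]
  rfl

theorem bundleAct_germ {x : X} {c d : C} (α : c ⟶ d) {U : Opens X} (hx : x ∈ U)
    (σ : (F.obj c).presheaf.obj (.op U)) :
    bundleAct F x α ((F.obj c).presheaf.germ U x hx σ) =
      (F.obj d).presheaf.germ U x hx ((F.map α).hom.app (.op U) σ) :=
  TopCat.Presheaf.stalkFunctor_map_germ_apply U x hx (F.map α).hom σ

end BundleAct

/-! ### Partial bijections given by their graphs -/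

open Classical in
theorem dite_choose_eq_some_iff {Y : Type u} {P : Y → Prop}
    (hP : ∀ y z, P y → P z → y = z) (z : Y) :
    (if h : ∃ y, P y then some h.choose else none) = some z ↔ P z := by
  constructor
  · intro h
    split_ifs at h with h'
    exact Option.some.inj h ▸ h'.choose_spec
  · intro hz
    have h : ∃ y, P y := ⟨z, hz⟩
    rw [dif_pos h]
    exact congrArg some (hP _ _ h.choose_spec hz)

open Classical in
/-- The partial bijection with a given graph. -/
noncomputable def PEquiv.ofGraph {Y : Type u} (R : Y → Y → Prop)
    (hfun : ∀ y z z', R y z → R y z' → z = z') (hinj : ∀ y y' z, R y z → R y' z → y = y') :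
    Y ≃. Y where
  toFun y := if h : ∃ z, R y z then some h.choose else none
  invFun z := if h : ∃ y, R y z then some h.choose else none
  inv y z := (dite_choose_eq_some_iff (fun y y' => hinj y y' z) y).trans
    (dite_choose_eq_some_iff (hfun y) z).symm

theorem PEquiv.mem_ofGraph {Y : Type u} {R : Y → Y → Prop}
    (hfun : ∀ y z z', R y z → R y z' → z = z') (hinj : ∀ y y' z, R y z → R y' z → y = y')
    {y z : Y} : z ∈ PEquiv.ofGraph R hfun hinj y ↔ R y z :=
  dite_choose_eq_some_iff (hfun y) z

/-! ### The `S`-set attached to a principal bundle -/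

namespace IsPrincipal

variable {S : Type u} [InverseSemigroup S] {X : TopCat.{u}}
  {F : Loganathan S ⥤ TopCat.Sheaf (Type u) X}

variable (F) in
/-- Formal products `m ⊗ w`, where `w` lies in the stalk over `x` at the object `𝐝(m)`. -/
structure Tensor (x : X) : Type u where
  obj : Loganathan S
  elt : S
  d_elt : d elt = obj.idem
  point : bundleStalk F x obj

/-- Two formal products are identified if they have a common refinement: `m ⊗ α u` is identified
with `n ⊗ β u` whenever `m α = n β`. -/
def Tensor.Rel {x : X} (p q : Tensor F x) : Prop :=
  ∃ (k : Loganathan S) (u : bundleStalk F x k) (α : k ⟶ p.obj) (β : k ⟶ q.obj),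
    bundleAct F x α u = p.point ∧ bundleAct F x β u = q.point ∧ p.elt * val α = q.elt * val β

variable (hF : IsPrincipal F)

include hF in
/-- Transitivity of the identification is where transitivity and freeness of the bundle enter. -/
theorem equivalence_rel (x : X) : Equivalence (Tensor.Rel (F := F) (x := x)) where
  refl p := ⟨p.obj, p.point, 𝟙 _, 𝟙 _, bundleAct_id F _, bundleAct_id F _, rfl⟩
  symm := by
    rintro p q ⟨k, u, α, β, h1, h2, h3⟩
    exact ⟨k, u, β, α, h2, h1, h3.symm⟩
  trans := by
    rintro p q r ⟨k, u, α, β, h1, h2, h3⟩ ⟨k', u', α', β', h1', h2', h3'⟩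
    obtain ⟨l, γ, γ', t, ht, ht'⟩ := hF.transitive x k k' u u'
    obtain ⟨l', δ, t', hδ, ht''⟩ := hF.free x l q.obj (γ ≫ β) (γ' ≫ α') t (by
      rw [bundleAct_comp, bundleAct_comp, ht, ht', h2, h1'])
    refine ⟨l', t', δ ≫ γ ≫ α, δ ≫ γ' ≫ β', ?_, ?_, ?_⟩
    · rw [bundleAct_comp, bundleAct_comp, ht'', ht, h1]
    · rw [bundleAct_comp, bundleAct_comp, ht'', ht', h2']
    · have h := congrArg val hδ
      simp only [val_comp] at h ⊢
      simp only [← mul_assoc] at h ⊢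
      rw [h3, mul_assoc q.elt, mul_assoc q.elt, h, ← h3']
      simp only [mul_assoc]

/-- The fibre over `x` of the universal `S`-set attached to a principal bundle. -/
def Fibre (x : X) : Type u := Quotient ⟨Tensor.Rel (F := F) (x := x), hF.equivalence_rel x⟩

/-- The total space of the universal `S`-set attached to a principal bundle. -/
def Total : Type u := Σ x : X, hF.Fibre x

/-- The point `m ⊗ w` of the total space. -/
def tensor {x : X} {b : Loganathan S} (m : S) (hm : d m = b.idem) (w : bundleStalk F x b) :
    hF.Total := ⟨x, Quotient.mk _ ⟨b, m, hm, w⟩⟩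

/-- The projection of the total space. -/
def proj (p : hF.Total) : X := p.1

theorem exists_tensor (p : hF.Total) : ∃ (x : X) (b : Loganathan S) (m : S) (hm : d m = b.idem)
    (w : bundleStalk F x b), p = hF.tensor m hm w := by
  obtain ⟨x, q⟩ := p
  induction q using Quotient.inductionOn with
  | h t => exact ⟨x, t.obj, t.elt, t.d_elt, t.point, rfl⟩

theorem tensor_congr {x : X} {b c k : Loganathan S} {m n : S} {hm : d m = b.idem}
    {hn : d n = c.idem} {w : bundleStalk F x b} {v : bundleStalk F x c}
    (u : bundleStalk F x k) (α : k ⟶ b) (β : k ⟶ c) (hw : bundleAct F x α u = w)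
    (hv : bundleAct F x β u = v) (h : m * val α = n * val β) :
    hF.tensor m hm w = hF.tensor n hn v :=
  congrArg (Sigma.mk x) (Quotient.sound ⟨k, u, α, β, hw, hv, h⟩)

theorem exists_of_tensor_eq {x : X} {b c : Loganathan S} {m n : S} {hm : d m = b.idem}
    {hn : d n = c.idem} {w : bundleStalk F x b} {v : bundleStalk F x c}
    (h : hF.tensor m hm w = hF.tensor n hn v) :
    ∃ (k : Loganathan S) (u : bundleStalk F x k) (α : k ⟶ b) (β : k ⟶ c),
      bundleAct F x α u = w ∧ bundleAct F x β u = v ∧ m * val α = n * val β :=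
  Quotient.exact (eq_of_heq (Sigma.mk.inj h).2)

theorem d_mul_val {b k : Loganathan S} {m : S} (hm : d m = b.idem) (α : k ⟶ b) :
    d (m * val α) = k.idem := by
  rw [d_mul_of_d_mul_eq, d_val]
  rw [hm, mul_val]

/-- The elements of `S` move across the tensor sign. -/
theorem tensor_bundleAct {x : X} {b k : Loganathan S} {m : S} (hm : d m = b.idem) (α : k ⟶ b)
    (u : bundleStalk F x k) :
    hF.tensor m hm (bundleAct F x α u) = hF.tensor (m * val α) (d_mul_val hm α) u :=
  hF.tensor_congr u α (𝟙 k) rfl (bundleAct_id F u) (by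
    rw [val_id, mul_assoc, ← d_val α, mul_d])

theorem tensor_elt_congr {x : X} {b : Loganathan S} {m n : S} {hm : d m = b.idem}
    (h : m = n) (w : bundleStalk F x b) :
    hF.tensor m hm w = hF.tensor n (h ▸ hm) w := by
  subst h; rfl

/-- The graph of the action of `s`: `s · (m ⊗ w) = s m ⊗ w` if `𝐝(s)` absorbs `m`. -/
def ActRel (s : S) (p q : hF.Total) : Prop :=
  ∃ (x : X) (b : Loganathan S) (m : S) (hm : d m = b.idem) (w : bundleStalk F x b)
    (hs : d s * m = m), p = hF.tensor m hm w ∧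
      q = hF.tensor (s * m) ((d_mul_of_d_mul_eq hs).trans hm) w

theorem actRel_fun (s : S) (p q q' : hF.Total) (h : hF.ActRel s p q) (h' : hF.ActRel s p q') :
    q = q' := by
  obtain ⟨x, b, m, hm, w, hs, rfl, rfl⟩ := h
  obtain ⟨x', b', m', hm', w', hs', h, rfl⟩ := h'
  obtain rfl : x = x' := congrArg hF.proj h
  obtain ⟨k, u, α, β, hα, hβ, hk⟩ := hF.exists_of_tensor_eq h
  exact hF.tensor_congr u α β hα hβ (by rw [mul_assoc, hk, mul_assoc])

theorem actRel_inj (s : S) (p p' q : hF.Total) (h : hF.ActRel s p q) (h' : hF.ActRel s p' q) :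
    p = p' := by
  obtain ⟨x, b, m, hm, w, hs, rfl, rfl⟩ := h
  obtain ⟨x', b', m', hm', w', hs', rfl, h⟩ := h'
  obtain rfl : x = x' := congrArg hF.proj h
  obtain ⟨k, u, α, β, hα, hβ, hk⟩ := hF.exists_of_tensor_eq h
  refine hF.tensor_congr u α β hα hβ ?_
  have hk' := congrArg (s⁻¹ * ·) hk
  unfold d at hs hs'
  simpa only [← mul_assoc, hs, hs'] using hk'

/-- The action of `S` on the total space. -/
noncomputable def action : SemigroupSet S hF.Total where
  act s := PEquiv.ofGraph (hF.ActRel s) (hF.actRel_fun s) (hF.actRel_inj s)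
  act_mul s t := by
    apply PEquiv.ext
    intro p
    apply Option.ext
    intro q
    change q ∈ PEquiv.ofGraph _ _ _ _ ↔ q ∈ PEquiv.trans _ _ _
    rw [PEquiv.mem_trans]
    simp only [PEquiv.mem_ofGraph]
    constructor
    · rintro ⟨x, b, m, hm, w, hs, rfl, rfl⟩
      have hs1 : t⁻¹ * (d s * (t * m)) = m := by
        rw [d_mul] at hs
        simpa only [mul_assoc] using hs
      have ht : d t * m = m := by
        unfold d
        rw [← hs1, ← mul_assoc, inv_mul_inv]
      have hst : d s * (t * m) = t * m := by
        have h := congrArg (t * ·) hs1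
        -- `t t⁻¹` commutes with `𝐝(s)` and is absorbed by `t`
        have hc : r t * (d s * (t * m)) = d s * (t * m) := by
          rw [← mul_assoc, idem_comm (isIdempotentElem_r t) (isIdempotentElem_d s), mul_assoc,
            ← mul_assoc (r t), r_mul]
        rw [← hc]
        unfold r
        rw [mul_assoc, h]
      refine ⟨_, ⟨x, b, m, hm, w, ht, rfl, rfl⟩, x, b, t * m,
        (d_mul_of_d_mul_eq ht).trans hm, w, hst, rfl, ?_⟩
      exact hF.tensor_elt_congr (mul_assoc s t m) w
    · rintro ⟨_, ⟨x, b, m, hm, w, ht, rfl, rfl⟩, ⟨x', c, n, hn, v, hs, h, rfl⟩⟩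
      obtain rfl : x = x' := congrArg hF.proj h
      obtain ⟨k, u, α, β, rfl, rfl, hk⟩ := hF.exists_of_tensor_eq h
      have hd : d (s * t) * (m * val α) = m * val α := by
        calc d (s * t) * (m * val α) = t⁻¹ * (d s * (t * m * val α)) := by
              rw [d_mul]; simp only [mul_assoc]
          _ = t⁻¹ * (d s * n * val β) := by rw [hk, mul_assoc]
          _ = t⁻¹ * (t * m * val α) := by rw [hs, hk]
          _ = d t * m * val α := by unfold d; simp only [mul_assoc]
          _ = m * val α := by rw [ht]
      refine ⟨x, k, m * val α, d_mul_val hm α, u, hd, hF.tensor_bundleAct hm α u, ?_⟩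
      rw [hF.tensor_bundleAct]
      exact hF.tensor_elt_congr (by rw [mul_assoc s n, ← hk]; simp only [mul_assoc]) u
  effective p := by
    obtain ⟨x, b, m, hm, w, rfl⟩ := hF.exists_tensor p
    have h : d (r m) * m = m := by rw [d_idem (isIdempotentElem_r m), r_mul]
    exact ⟨r m, Option.isSome_iff_exists.2
      ⟨_, (PEquiv.mem_ofGraph _ _).2 ⟨x, b, m, hm, w, h, rfl, rfl⟩⟩⟩

theorem mem_action {s : S} {p q : hF.Total} : q ∈ hF.action.act s p ↔ hF.ActRel s p q :=
  PEquiv.mem_ofGraph (hF.actRel_fun s) (hF.actRel_inj s)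

theorem proj_action (s : S) (p q : hF.Total) (h : q ∈ hF.action.act s p) :
    hF.proj q = hF.proj p := by
  obtain ⟨x, b, m, hm, w, hs, rfl, rfl⟩ := hF.mem_action.1 h
  rfl

theorem tensor_mem_act {s : S} {x : X} {b : Loganathan S} {m : S} (hm : d m = b.idem)
    (w : bundleStalk F x b) (hs : d s * m = m) :
    hF.tensor (s * m) ((d_mul_of_d_mul_eq hs).trans hm) w ∈ hF.action.act s (hF.tensor m hm w) :=
  hF.mem_action.2 ⟨x, b, m, hm, w, hs, rfl, rfl⟩

theorem tensor_mem_act_mul_inv {x : X} {b : Loganathan S} {m n : S} (hm : d m = b.idem)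
    (hn : d n = b.idem) (w : bundleStalk F x b) :
    hF.tensor n hn w ∈ hF.action.act (n * m⁻¹) (hF.tensor m hm w) := by
  have hs : d (n * m⁻¹) * m = m := by
    rw [d_mul, inv_inv', hn, ← hm]
    unfold d
    simp only [← mul_assoc, mul_inv_mul]
  have h := hF.tensor_mem_act hm w hs
  have hc : n * m⁻¹ * m = n := by
    rw [mul_assoc]
    change n * d m = n
    rw [hm, ← hn, mul_d]
  rwa [hF.tensor_elt_congr hc] at h

/-- The point `e ⊗ y` of the total space that is given by a point `y` of the stalk at `e`. -/
def pt {x : X} (e : Loganathan S) (y : bundleStalk F x e) : hF.Total :=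
  hF.tensor e.idem (d_idem e.isIdem) y

theorem pt_bundleAct {x : X} {e f : Loganathan S} (α : e ⟶ f) (y : bundleStalk F x e) :
    hF.pt f (bundleAct F x α y) = hF.tensor (val α) (d_val α) y :=
  (hF.tensor_bundleAct _ α y).trans (hF.tensor_elt_congr (mul_val α) y)

theorem pt_bundleAct_mem {x : X} {e f : Loganathan S} (α : e ⟶ f) (y : bundleStalk F x e) :
    hF.pt f (bundleAct F x α y) ∈ hF.action.act (val α) (hF.pt e y) := by
  have h := hF.tensor_mem_act (s := val α) (d_idem e.isIdem) y (by rw [d_val, e.isIdem.eq])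
  rw [pt_bundleAct]
  have hα : val α * e.idem = val α := by rw [← d_val α, mul_d]
  rwa [hF.tensor_elt_congr hα] at h

theorem pt_injective {x : X} (e : Loganathan S) :
    Function.Injective (hF.pt (x := x) e) := by
  intro y z h
  obtain ⟨k, u, α, β, rfl, rfl, hk⟩ := hF.exists_of_tensor_eq h
  rw [mul_val, mul_val] at hk
  rw [hom_ext hk]

theorem pt_mem_act {x : X} (e : Loganathan S) (y : bundleStalk F x e) :
    hF.pt e y ∈ hF.action.act e.idem (hF.pt e y) := by
  have h := hF.pt_bundleAct_mem (𝟙 e) y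
  rwa [bundleAct_id] at h

/-- If `s` is defined at a point `p` then `p = 𝐝(s) ⊗ y` for a point `y` of the stalk at `𝐝(s)`. -/
theorem exists_pt_of_mem_act {s : S} {p q : hF.Total} (h : q ∈ hF.action.act s p)
    {e : Loganathan S} (he : d s = e.idem) :
    ∃ y : bundleStalk F (hF.proj p) e, p = hF.pt e y := by
  obtain ⟨x, b, m, hm, w, hs, rfl, rfl⟩ := hF.mem_action.1 h
  exact ⟨bundleAct F x (arr m hm e (he ▸ hs)) w, (hF.pt_bundleAct (arr m hm e (he ▸ hs)) w).symm⟩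

theorem exists_pt (p : hF.Total) :
    ∃ (e : Loganathan S) (y : bundleStalk F (hF.proj p) e), p = hF.pt e y := by
  obtain ⟨s, hs⟩ := hF.action.effective p
  obtain ⟨q, hq⟩ := Option.isSome_iff_exists.1 hs
  exact ⟨⟨d s, isIdempotentElem_d s⟩, hF.exists_pt_of_mem_act hq rfl⟩

theorem isTransFree_stalk (x : X) :
    (hF.action.stalk hF.proj hF.proj_action x).IsTransFree where
  nonempty := by
    obtain ⟨c, ⟨y⟩⟩ := hF.nonempty x
    exact ⟨⟨hF.pt c y, rfl⟩⟩
  trans := by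
    rintro ⟨p, rfl⟩ ⟨q, hq⟩
    obtain ⟨x, b, m, hm, w, rfl⟩ := hF.exists_tensor p
    obtain ⟨x', c, n, hn, v, rfl⟩ := hF.exists_tensor q
    obtain rfl : x' = x := hq
    obtain ⟨k, α, β, u, rfl, rfl⟩ := hF.transitive x' b c w v
    refine ⟨n * val β * (m * val α)⁻¹, (mem_stalkPEquiv _ _ (hF.proj_action _) _ _ _).2 ?_⟩
    simp only [tensor_bundleAct]
    exact hF.tensor_mem_act_mul_inv _ _ u
  free := by
    rintro s t ⟨p, rfl⟩ ⟨q, hq⟩ hs ht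
    replace hs := (mem_stalkPEquiv _ _ (hF.proj_action _) _ _ _).1 hs
    replace ht := (mem_stalkPEquiv _ _ (hF.proj_action _) _ _ _).1 ht
    obtain ⟨x, b, m, hm, w, hms, rfl, rfl⟩ := hF.mem_action.1 hs
    obtain ⟨x', c, n, hn, v, hnt, h, h'⟩ := hF.mem_action.1 ht
    obtain rfl : x = x' := congrArg hF.proj h
    obtain ⟨k, u, α, β, rfl, rfl, hk⟩ := hF.exists_of_tensor_eq h
    replace h' := (hF.tensor_bundleAct _ α u).symm.trans
      (h'.trans (hF.tensor_bundleAct _ β u))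
    obtain ⟨l, u', γ, γ', hγ, hγ', hl⟩ := hF.exists_of_tensor_eq h'
    obtain ⟨l', δ, z, hδ, rfl⟩ := hF.free x l k γ γ' u' (hγ.trans hγ'.symm)
    -- `a` represents the point, and `s a = t a`
    let a := m * val (δ ≫ γ ≫ α)
    have hpt : hF.tensor m hm (bundleAct F x α u) = hF.tensor a (d_mul_val hm _) z := by
      rw [← tensor_bundleAct, bundleAct_comp, bundleAct_comp, hγ]
    have hst : s * a = t * a := by
      have hδ' := congrArg val hδ
      simp only [val_comp] at hδ'
      calc s * a = s * m * val α * val γ * val δ := by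
            simp only [a, val_comp, mul_assoc]
        _ = t * (n * val β) * (val γ' * val δ) := by rw [hl]; simp only [mul_assoc]
        _ = t * a := by
            rw [← hk, ← hδ']
            simp only [a, val_comp, mul_assoc]
    refine ⟨r a, isIdempotentElem_r a, (mem_stalkPEquiv _ _ (hF.proj_action _) _ _ _).2 ?_, ?_⟩
    · rw [hpt]
      have h := hF.tensor_mem_act (s := r a) (d_mul_val hm _) z
        (show d (r a) * a = a by rw [d_idem (isIdempotentElem_r a), r_mul])
      rwa [hF.tensor_elt_congr (r_mul a)] at h
    · unfold r
      rw [← mul_assoc, hst, mul_assoc]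

/-! ### The étale space attached to a principal bundle -/

/-- The section `x ↦ e ⊗ σ_x` of the total space that is given by a section `σ` of `F(e)`. -/
noncomputable def sec {e : Loganathan S} {U : Opens X} (σ : (F.obj e).presheaf.obj (.op U))
    (x : U) : hF.Total := hF.pt e ((F.obj e).presheaf.germ U x.1 x.2 σ)

/-- The finest topology for which the sections `x ↦ e ⊗ σ_x` are continuous. -/
noncomputable instance : TopologicalSpace hF.Total :=
  ⨆ (e : Loganathan S) (U : Opens X) (σ : (F.obj e).presheaf.obj (.op U)),
    TopologicalSpace.coinduced (hF.sec σ) inferInstance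

theorem isOpen_iff {V : Set hF.Total} : IsOpen V ↔ ∀ (e : Loganathan S) (U : Opens X)
    (σ : (F.obj e).presheaf.obj (.op U)), IsOpen (hF.sec σ ⁻¹' V) := by
  simp only [isOpen_iSup_iff, isOpen_coinduced]

theorem continuous_sec {e : Loganathan S} {U : Opens X}
    (σ : (F.obj e).presheaf.obj (.op U)) : Continuous (hF.sec σ) :=
  ⟨fun _ hV => hF.isOpen_iff.1 hV e U σ⟩

theorem exists_sec (p : hF.Total) : ∃ (e : Loganathan S) (U : Opens X) (hx : hF.proj p ∈ U)
    (σ : (F.obj e).presheaf.obj (.op U)), hF.sec σ ⟨hF.proj p, hx⟩ = p := by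
  obtain ⟨e, y, hp⟩ := hF.exists_pt p
  obtain ⟨U, hx, σ, rfl⟩ := (F.obj e).presheaf.exists_germ_eq y
  exact ⟨e, U, hx, σ, hp.symm⟩

theorem sec_mem_act {e f : Loganathan S} (α : e ⟶ f) {U : Opens X}
    (σ : (F.obj e).presheaf.obj (.op U)) (x : U) :
    hF.sec ((F.map α).hom.app (.op U) σ) x ∈ hF.action.act (val α) (hF.sec σ x) := by
  have h := hF.pt_bundleAct_mem α ((F.obj e).presheaf.germ U x.1 x.2 σ)
  rwa [bundleAct_germ] at h

/-- Sections of sheaves with the same germ at a point have the same germs nearby. -/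
theorem exists_germ_eq_near {G : TopCat.Sheaf (Type u) X} {U V : Opens X} {x : X}
    (hU : x ∈ U) (hV : x ∈ V) (σ : G.presheaf.obj (.op U)) (τ : G.presheaf.obj (.op V))
    (h : G.presheaf.germ U x hU σ = G.presheaf.germ V x hV τ) :
    ∃ (W : Opens X) (_ : x ∈ W) (hWU : W ≤ U) (hWV : W ≤ V), ∀ z (hz : z ∈ W),
      G.presheaf.germ U z (hWU hz) σ = G.presheaf.germ V z (hWV hz) τ := by
  obtain ⟨W, hx, iU, iV, hW⟩ := G.presheaf.germ_eq x hU hV σ τ h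
  refine ⟨W, hx, iU.le, iV.le, fun z hz => ?_⟩
  rw [← G.presheaf.germ_res_apply iU z hz, hW, G.presheaf.germ_res_apply]

/-- Sections of the total space that meet at a point agree nearby. -/
theorem exists_sec_eq_near {e f : Loganathan S} {U V : Opens X} {x : X} (hU : x ∈ U) (hV : x ∈ V)
    (σ : (F.obj e).presheaf.obj (.op U)) (τ : (F.obj f).presheaf.obj (.op V))
    (h : hF.sec σ ⟨x, hU⟩ = hF.sec τ ⟨x, hV⟩) :
    ∃ (W : Opens X) (_ : x ∈ W) (hWU : W ≤ U) (hWV : W ≤ V), ∀ z (hz : z ∈ W),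
      hF.sec σ ⟨z, hWU hz⟩ = hF.sec τ ⟨z, hWV hz⟩ := by
  obtain ⟨k, u, α, β, hα, hβ, hk⟩ := hF.exists_of_tensor_eq h
  obtain ⟨N, hx, ω, rfl⟩ := (F.obj k).presheaf.exists_germ_eq u
  rw [bundleAct_germ] at hα hβ
  obtain ⟨W, hxW, hWN, hWU, hW⟩ := exists_germ_eq_near hx hU _ σ hα
  obtain ⟨W', hxW', hWN', hWV, hW'⟩ := exists_germ_eq_near hx hV _ τ hβ
  refine ⟨W ⊓ W', ⟨hxW, hxW'⟩, inf_le_left.trans hWU, inf_le_right.trans hWV, fun z hz => ?_⟩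
  refine hF.tensor_congr ((F.obj k).presheaf.germ N z (hWN hz.1) ω) α β ?_ ?_ hk
  · rw [bundleAct_germ]
    exact hW z hz.1
  · rw [bundleAct_germ]
    exact hW' z hz.2

theorem isOpenMap_sec {e : Loganathan S} {U : Opens X}
    (σ : (F.obj e).presheaf.obj (.op U)) : IsOpenMap (hF.sec σ) := by
  intro N hN
  rw [isOpen_iff]
  intro f V τ
  rw [isOpen_iff_forall_mem_open]
  rintro ⟨x, hx⟩ ⟨⟨x', hx'⟩, hxN, h⟩
  obtain rfl : x' = x := congrArg hF.proj h
  obtain ⟨W, hxW, hWU, hWV, hW⟩ := hF.exists_sec_eq_near hx' hx σ τ h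
  refine ⟨Subtype.val ⁻¹' (W.1 ∩ Subtype.val '' N), ?_, ?_, hxW, _, hxN, rfl⟩
  · rintro ⟨z, hz⟩ ⟨hzW, ⟨z', hz'⟩, hzN, rfl⟩
    exact ⟨_, hzN, hW _ hzW⟩
  · exact (W.isOpen.inter (U.isOpen.isOpenMap_subtype_val N hN)).preimage continuous_subtype_val

theorem isOpenEmbedding_sec {e : Loganathan S} {U : Opens X}
    (σ : (F.obj e).presheaf.obj (.op U)) : Topology.IsOpenEmbedding (hF.sec σ) :=
  .of_continuous_injective_isOpenMap (hF.continuous_sec σ)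
    (fun _ _ h => Subtype.ext (congrArg hF.proj h)) (hF.isOpenMap_sec σ)

theorem isLocalHomeomorph_proj : IsLocalHomeomorph hF.proj := by
  intro p
  obtain ⟨e, U, hx, σ, hp⟩ := hF.exists_sec p
  have h : IsLocalHomeomorphOn (hF.proj ∘ hF.sec σ) Set.univ :=
    isLocalHomeomorph_iff_isLocalHomeomorphOn_univ.1
      U.isOpen.isOpenEmbedding_subtypeVal.isLocalHomeomorph
  exact h.of_comp_right (hF.isOpenEmbedding_sec σ).isLocalHomeomorph.isLocalHomeomorphOn p
    ⟨_, trivial, hp⟩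

/-- Preimages of open sets under the action of a single element are open. -/
theorem isOpen_preimage_act (s : S) {V : Set hF.Total} (hV : IsOpen V) :
    IsOpen {p | ∃ q ∈ hF.action.act s p, q ∈ V} := by
  rw [isOpen_iff]
  intro e U σ
  rw [isOpen_iff_forall_mem_open]
  rintro ⟨x, hx⟩ ⟨q, hq, hqV⟩
  let a : Loganathan S := ⟨d s, isIdempotentElem_d s⟩
  let α : a ⟶ ⟨r s, isIdempotentElem_r s⟩ := arr s rfl _ (r_mul s)
  -- near `x` the section `σ` has the form `d(s) ⊗ τ`, and there `s` takes it to `r(s) ⊗ s τ`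
  obtain ⟨y, hy⟩ := hF.exists_pt_of_mem_act (e := a) hq rfl
  change bundleStalk F x a at y
  obtain ⟨N, hxN, τ, rfl⟩ := (F.obj a).presheaf.exists_germ_eq y
  obtain ⟨W, hxW, hWU, hWN, hW⟩ := hF.exists_sec_eq_near hx hxN σ τ hy
  have hτ := hF.sec_mem_act α τ
  let τ' := (F.map α).hom.app (.op N) τ
  refine ⟨Subtype.val ⁻¹' (W.1 ∩ Subtype.val '' (hF.sec τ' ⁻¹' V)), ?_, ?_, hxW, ⟨x, hxN⟩, ?_, rfl⟩
  · rintro ⟨z, hz⟩ ⟨hzW, ⟨z', hz'⟩, hzV, rfl⟩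
    refine ⟨_, ?_, hzV⟩
    rw [hW _ hzW]
    exact hτ _
  · exact (W.isOpen.inter (N.isOpen.isOpenMap_subtype_val _
      (hV.preimage (hF.continuous_sec τ')))).preimage continuous_subtype_val
  · have h := hτ ⟨x, hxN⟩
    rw [← hW x hxW] at h
    change hF.sec τ' ⟨x, hxN⟩ ∈ V
    rwa [SemigroupSet.act_unique h hq]

/-- The universal `S`-set over `X` that is attached to a principal bundle. -/
noncomputable def toUniv : Univ S X where
  E := hF.Total
  proj := hF.proj
  isLocalHomeomorph := hF.isLocalHomeomorph_proj
  action := hF.action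
  stalk_effective x := by
    obtain ⟨c, ⟨y⟩⟩ := hF.nonempty x
    exact ⟨hF.pt c y, rfl, hF.action.effective _⟩
  isOpen_dom s := by
    have h := hF.isOpen_preimage_act s isOpen_univ
    simpa only [Set.mem_univ, and_true, Option.isSome_iff_exists, Option.mem_def] using h
  proj_act := hF.proj_action
  universal x := (hF.isTransFree_stalk x).isUniversal
  continuous_act := by
    let _ : TopologicalSpace S := ⊥
    have : DiscreteTopology S := ⟨rfl⟩
    refine ⟨fun V hV => ?_⟩
    -- on the slice over `s`, the preimage of `V` is cut out by an open set
    have h : IsOpen {p : S × hF.Total | ∃ q ∈ hF.action.act p.1 p.2, q ∈ V} := by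
      have hu : {p : S × hF.Total | ∃ q ∈ hF.action.act p.1 p.2, q ∈ V} =
          ⋃ s : S, {s} ×ˢ {p | ∃ q ∈ hF.action.act s p, q ∈ V} := by
        ext ⟨s, p⟩
        simp
      rw [hu]
      exact isOpen_iUnion fun s => (isOpen_discrete {s}).prod (hF.isOpen_preimage_act s hV)
    convert h.preimage continuous_subtype_val using 1
    ext ⟨⟨s, p⟩, hp⟩
    constructor
    · exact fun h => ⟨_, Option.get_mem _, h⟩
    · rintro ⟨q, hq, hqV⟩
      change (hF.action.act s p).get hp ∈ V
      rwa [SemigroupSet.act_unique (Option.get_mem hp) hq]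

/-- The comparison of a principal bundle with the sections of its total space. -/
noncomputable def unit : F ⟶ hF.toUniv.toFunctor where
  app e := ⟨{
    app U := ↾fun σ => ⟨fun x => ⟨hF.sec σ x, rfl, hF.pt_mem_act e _⟩, hF.continuous_sec σ⟩
    naturality U V i := by
      ext σ
      refine Subtype.ext (funext fun x => Subtype.ext ?_)
      exact congrArg (hF.pt e) ((F.obj e).presheaf.germ_res_apply' i x.1 x.2 σ) }⟩
  naturality e f α := by
    refine sheaf_hom_ext fun U σ => Subtype.ext (funext fun x => ?_)
    exact ((Univ.fibAct_eq_iff α _ _).2 (hF.sec_mem_act α σ x)).symm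

theorem stalkEquiv_unit (e : Loganathan S) (x : X) (y : bundleStalk F x e) :
    (hF.toUniv.stalkEquiv e x
      ((TopCat.Presheaf.stalkFunctor (Type u) x).map (hF.unit.app e).hom y)).1 = hF.pt e y := by
  obtain ⟨U, hx, σ, rfl⟩ := (F.obj e).presheaf.exists_germ_eq y
  rw [TopCat.Presheaf.stalkFunctor_map_germ_apply]
  exact congrArg Subtype.val (hF.toUniv.stalkEquiv_germ e hx _)

instance isIso_unit_app (e : Loganathan S) : IsIso (hF.unit.app e) := by
  have (x : X) : IsIso ((TopCat.Presheaf.stalkFunctor (Type u) x).map (hF.unit.app e).hom) := by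
    rw [isIso_iff_bijective]
    refine (Function.Bijective.of_comp_iff' (hF.toUniv.stalkEquiv e x).bijective _).1 ⟨?_, ?_⟩
    · intro y z h
      exact hF.pt_injective e ((hF.stalkEquiv_unit e x y).symm.trans
        ((congrArg Subtype.val h).trans (hF.stalkEquiv_unit e x z)))
    · rintro ⟨p, rfl, hp⟩
      obtain ⟨y, hy⟩ := hF.exists_pt_of_mem_act hp (d_idem e.isIdem)
      exact ⟨y, Subtype.ext ((hF.stalkEquiv_unit e _ y).trans hy.symm)⟩
  exact TopCat.Presheaf.isIso_of_stalkFunctor_map_iso (hF.unit.app e)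

instance isIso_unit : IsIso hF.unit := NatIso.isIso_of_isIso_app _

end IsPrincipal

/-! ### The equivalence -/

instance (S : Type u) [InverseSemigroup S] (X : TopCat.{u}) : (Univ.toPrin S X).EssSurj where
  mem_essImage E :=
    ⟨E.property.toUniv, ⟨ObjectProperty.isoMk _ (asIso E.property.unit).symm⟩⟩

/-- For an inverse semigroup `S` and a topological space `X`, the category of principal bundles
over `S` on `X` is equivalent to the category of universal `S`-sets over `X`. -/
theorem theorem4 (S : Type u) [InverseSemigroup S] (X : TopCat.{u}) :
    Nonempty (Prin S X ≌ Univ S X) := by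
  have : (Univ.toPrin S X).IsEquivalence := {}
  exact ⟨(Univ.toPrin S X).asEquivalence.symm⟩
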